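/- **Setting.** Let $\mathbb T=\mathbb R/\mathbb Z$, and let $\mathbb T^2$ carry the product (maximum) metric $d$. Fix: a minimal rotation $T(x,y)=(x+a,y+b)$ of $\mathbb T^2$; a point $z_0\in\mathbb T^2$; reals $1=\epsilon_0>\epsilon_1>\cdots>0$ with $\epsilon_k\to0$; for each $k$ points $\epsilon_{k+1}<e^1_k<e^2_k<e^3_k<\epsilon_k$; and a sequence $(q_k)_{k\ge 0}$ dense in $[0,1]$. Put $z_{2n}=T^nz_0$, $z_{2n+1}=T^{-n-1}z_0$, $z_n=(x_n,y_n)$, $X=(\mathbb T\setminus\{x_n:n\ge 0\})\times\mathbb T$, and let $\sigma,\tau$ be the permutations of $\mathbb N=\{0,1,\dots\}$ with $Tz_n=z_{\sigma(n)}$, $T^{-1}z_n=z_{\tau(n)}$. For $\alpha\in[0,1]^{\mathbb N}$ let $p_\alpha:(0,1]\to\mathbb R$ be the continuous function that equals $q_k/4$ on $[\epsilon_{k+1},e^1_k]$ and $\alpha(k)/4$ on $[e^2_k,e^3_k]$, is affine on $[e^1_k,e^2_k]$ and on $[e^3_k,\epsilon_k]$, and has $p_\alpha(1)=-1/4$.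 Let $h^\alpha_0:[-1,1]\to[-1,1]$ be the function whose graph is the polyline $(-1,-1),(-\frac12,0),(\frac12,0),(1,1)$; for $0<t\le 1$ let the graph of $h^\alpha_t=h^\alpha_{-t}$ be the polyline $$(-1,-1),\ \left(\tfrac{-1-t}2,-t\right),\ \left(-\tfrac12,-\tfrac t2\right),\ \left(-p_\alpha(t),\tfrac t4\right),\ \left(\tfrac12,\tfrac t2\right),\ \left(\tfrac{1+t}2,t\right),\ (1,1).$$ Given positive reals $\delta=(\delta_n)_{n\ge0}$, let $A_n=\{z_n+(t,s):|t|,|s|\le\delta_n\}$, let $\Lambda_n:\mathbb T^2\to\mathbb T^2$ be the identity off $A_n$ and $$\Lambda_n(z_n+(t,s))=z_n+\left(t,\ h^\alpha_t\left((h^\alpha_{\delta_n})^{-1}(s)\right)\right)\qquad(|t|,|s|\le\delta_n),$$ and put $\Phi_n=\Lambda_n\circ\cdots\circ\Lambda_0$, $\Phi^\sigma_n=\Lambda_{\sigma(n)}\circ\cdots\circ\Lambda_{\sigma(0)}$, $\Phi^\tau_n=\Lambda_{\tau(n)}\circ\cdots\circ\Lambda_{\tau(0)}$, $\Phi_\alpha=\lim_n\Phi_n$.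 Call $\delta$ *admissible for $\alpha$* if 1. $A_m\cap A_n=\emptyset$ whenever $0<|m-n|\le5$; 2. $\delta_n<2^{-n}$; $A_n\cap(\{x_m\}\times\mathbb T)=\emptyset$ and $\delta_n<|x_m-x_n|/n$ for all $m<n$; and for $n\ge1$ and $u,v\in\{x_n\}\times\mathbb T$, $d(\Phi_{n-1}(u),\Phi_{n-1}(v))\le\delta_n$ implies $d(u,v)<1/n$; 3. there are integers $a_n\ge2$ with $\prod_{n\ge1}(1-1/a_n)>0$ such that, for all $m>n\ge1$ and all $u,v\in\mathbb T^2$ with $d(u,v)\ge1/n$, $d(\Phi_m(u),\Phi_m(v))\ge\prod_{r=n+1}^m(1-1/a_r)\,d(\Phi_n(u),\Phi_n(v))$; 4. the maps $(\Phi^\sigma_n)^{-1}\circ T\circ\Phi_n$ are uniformly continuous on $X$ and form a uniformly Cauchy sequence on $X$, and so do the maps $(\Phi^\tau_n)^{-1}\circ T^{-1}\circ\Phi_n$. (The inverses are those of the bijections $\Phi^\sigma_n,\Phi^\tau_n:X\to X$.) **Theorem.** (i) For every $\alpha\in[0,1]^{\mathbb N}$ there is a sequence $\delta$ that is admissible for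 $\alpha$. (ii) For every $\alpha$ and every $\delta$ admissible for $\alpha$, $\Phi_\alpha$ restricts to a bijection of $X$, there is exactly one homeomorphism $S_\alpha$ of $\mathbb T^2$ that extends $(\Phi_\alpha|_X)^{-1}\circ T\circ\Phi_\alpha|_X$, and $S_\alpha$ is minimal. (iii) If $\alpha,\beta\in[0,1]^{\mathbb N}$ satisfy $\lim_n|\alpha(n)-\beta(n)|=0$, then, for any sequences admissible for $\alpha$ and for $\beta$ respectively, the homeomorphisms $S_\alpha$ and $S_\beta$ so obtained are topologically conjugate. -/

import Mathlib

open Set Filter Topology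

noncomputable section

/-- The torus, with its product (supremum) metric; each circle factor `ℝ / ℤ` carries the arc-length
metric. -/
abbrev Torus : Type := UnitAddCircle × UnitAddCircle

/-- A homeomorphism is minimal if every (two-sided) orbit is dense. -/
def IsMinimalHomeo {X : Type*} [TopologicalSpace X] (f : X ≃ₜ X) : Prop :=
  ∀ x : X, Dense (range fun n : ℤ => (f ^ n) x)

/-- Topological conjugacy of two homeomorphisms. -/
def TopConjugate {X Y : Type*} [TopologicalSpace X] [TopologicalSpace Y]
    (f : X ≃ₜ X) (g : Y ≃ₜ Y) : Prop :=
  ∃ h : X ≃ₜ Y, Function.Semiconj h f g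

/-- The relation `c₀` on sequences in `[0,1]`. -/
def C0Rel (α β : ℕ → unitInterval) : Prop :=
  Tendsto (fun n => |(α n : ℝ) - (β n : ℝ)|) atTop (𝓝 0)

/-- The rotation `(x, y) ↦ (x + a, y + b)` of the torus by `v = (a, b)`. -/
def torusRotation (v : Torus) : Torus ≃ₜ Torus := Homeomorph.addRight v

/-- The polyline through a list of points with increasing abscissas, as a function of the
abscissa. -/
def polyline : List (ℝ × ℝ) → ℝ → ℝ
  | [], _ => 0
  | [p], _ => p.2
  | p :: q :: l, s =>
      if s ≤ q.1 then p.2 + (q.2 - p.2) / (q.1 - p.1) * (s - p.1) else polyline (q :: l) s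

/-- The choices that are fixed once and for all: a minimal rotation, a base point, a sequence
`1 = ε₀ > ε₁ > ⋯ → 0`, a division `ε (k+1) < e₁ k < e₂ k < e₃ k < ε k` of each
`[ε (k+1), ε k]` into four intervals, and a dense sequence `q` in `[0,1]`. -/
structure ReesData where
  v : Torus
  rotation_minimal : IsMinimalHomeo (torusRotation v)
  z₀ : Torus
  ε : ℕ → ℝ
  ε_zero : ε 0 = 1
  ε_pos : ∀ k, 0 < ε k
  ε_tendsto : Tendsto ε atTop (𝓝 0)
  e₁ : ℕ → ℝ
  e₂ : ℕ → ℝ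
  e₃ : ℕ → ℝ
  ε_lt_e₁ : ∀ k, ε (k + 1) < e₁ k
  e₁_lt_e₂ : ∀ k, e₁ k < e₂ k
  e₂_lt_e₃ : ∀ k, e₂ k < e₃ k
  e₃_lt_ε : ∀ k, e₃ k < ε k
  q : ℕ → ℝ
  q_mem : ∀ k, q k ∈ Icc (0 : ℝ) 1
  q_dense : Icc (0 : ℝ) 1 ⊆ closure (range q)

namespace ReesData

variable (P : ReesData) (α : ℕ → unitInterval) (δ : ℕ → ℝ)

/-- The fixed minimal rotation. -/
def T : Torus ≃ₜ Torus := torusRotation P.v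

/-- The enumeration of the orbit of `z₀`: `z (2n) = T ^ n z₀` and `z (2n+1) = T ^ (-n-1) z₀`. -/
def z (n : ℕ) : Torus := (P.T ^ (Equiv.intEquivNat.symm n)) P.z₀

/-- The permutation `σ` of `ℕ` with `T (z n) = z (σ n)`. -/
def σ (n : ℕ) : ℕ := Equiv.intEquivNat (Equiv.intEquivNat.symm n + 1)

/-- The permutation `τ` of `ℕ` with `T⁻¹ (z n) = z (τ n)`. -/
def τ (n : ℕ) : ℕ := Equiv.intEquivNat (Equiv.intEquivNat.symm n - 1)

/-- The set of the points that lie on none of the columns `{xₙ} × 𝕋`. -/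
def X : Set Torus := {p | ∀ n, p.1 ≠ (P.z n).1}

/-- For `0 < t ≤ 1`, the index `k` with `ε (k+1) ≤ t < ε k` (and `k = 0` for `t = 1`). -/
def level (t : ℝ) : ℕ := sInf {k | P.ε (k + 1) ≤ t}

/-- The function `p_α` on `(0,1]`: on the `k`-th interval it is `q k / 4` on `[ε (k+1), e₁ k]`,
`α k / 4` on `[e₂ k, e₃ k]`, and affine in between; the value at `ε k` is `q (k-1) / 4` for
`k ≥ 1`, and `-1/4` for `k = 0`. -/
def pFun (t : ℝ) : ℝ :=
  let k := P.level t
  polyline [(P.ε (k + 1), P.q k / 4), (P.e₁ k, P.q k / 4), (P.e₂ k, α k / 4), (P.e₃ k, α k / 4),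
    (P.ε k, if k = 0 then -1 / 4 else P.q (k - 1) / 4)] t

/-- The function `h^α_t` on `[-1,1]`, for `t ∈ [-1,1]`; it depends on `|t|` only. -/
def h (t : ℝ) : ℝ → ℝ :=
  if t = 0 then polyline [(-1, -1), (-1 / 2, 0), (1 / 2, 0), (1, 1)]
  else polyline [(-1, -1), ((-1 - |t|) / 2, -|t|), (-1 / 2, -|t| / 2), (-P.pFun α |t|, |t| / 4),
    (1 / 2, |t| / 2), ((1 + |t|) / 2, |t|), (1, 1)]

/-- The inverse of `h^α_t : [-1,1] → [-1,1]`, for `t ≠ 0`. -/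
def hInv (t : ℝ) : ℝ → ℝ := Function.invFunOn (P.h α t) (Icc (-1) 1)

/-- The representative in `[-1/2, 1/2)` of a point of the circle. -/
def coord (x : UnitAddCircle) : ℝ := (AddCircle.equivIco (1 : ℝ) (-1 / 2) x : ℝ)

/-- The closed square with centre `z n` and side `2 δ n`. -/
def square (n : ℕ) : Set Torus :=
  {p | ∃ t s : ℝ, |t| ≤ δ n ∧ |s| ≤ δ n ∧
    p = ((P.z n).1 + (t : UnitAddCircle), (P.z n).2 + (s : UnitAddCircle))}

/-- The map `Λ_{α,n}`: the identity off the square, and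
`zₙ + (t, s) ↦ zₙ + (t, h^α_t ((h^α_{δₙ})⁻¹ s))` on it. -/
def Lam (n : ℕ) (p : Torus) : Torus :=
  let t := coord (p.1 - (P.z n).1)
  let s := coord (p.2 - (P.z n).2)
  if |t| ≤ δ n ∧ |s| ≤ δ n then
    (p.1, (P.z n).2 + ((P.h α t (P.hInv α (δ n) s) : ℝ) : UnitAddCircle))
  else p

/-- `Λ_{α,π(n)} ∘ ⋯ ∘ Λ_{α,π(0)}`. -/
def PhiPerm (π : ℕ → ℕ) : ℕ → Torus → Torus
  | 0 => P.Lam α δ (π 0)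
  | n + 1 => P.Lam α δ (π (n + 1)) ∘ PhiPerm π n

/-- `Φ_{α,n} = Λ_{α,n} ∘ ⋯ ∘ Λ_{α,0}`. -/
def PhiSeq (n : ℕ) : Torus → Torus := P.PhiPerm α δ id n

/-- `Φ_α`, the (uniform) limit of the maps `Φ_{α,n}`. -/
def Phi (p : Torus) : Torus := limUnder atTop fun n => P.PhiSeq α δ n p

/-- `(Φ^σ_{α,n})⁻¹ ∘ T ∘ Φ_{α,n}` on `X`. -/
def fwd (n : ℕ) (p : Torus) : Torus :=
  Function.invFunOn (P.PhiPerm α δ σ n) P.X (P.T (P.PhiSeq α δ n p))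

/-- `(Φ^τ_{α,n})⁻¹ ∘ T⁻¹ ∘ Φ_{α,n}` on `X`. -/
def bwd (n : ℕ) (p : Torus) : Torus :=
  Function.invFunOn (P.PhiPerm α δ τ n) P.X (P.T.symm (P.PhiSeq α δ n p))

/-- The conditions imposed on the half-sides `δ n = δ_{α,n}` of the squares. -/
structure Admissible : Prop where
  pos : ∀ n, 0 < δ n
  disjoint_near : ∀ m n : ℕ, m ≠ n → m ≤ n + 5 → n ≤ m + 5 →
    Disjoint (P.square δ m) (P.square δ n)
  lt_two_pow : ∀ n, δ n < 1 / 2 ^ n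
  disjoint_column : ∀ n, ∀ m < n, ∀ p ∈ P.square δ n, p.1 ≠ (P.z m).1
  lt_dist : ∀ n, ∀ m < n, δ n < dist (P.z m).1 (P.z n).1 / n
  small_fibre : ∀ n, ∀ p q : Torus, p.1 = (P.z (n + 1)).1 → q.1 = (P.z (n + 1)).1 →
    dist (P.PhiSeq α δ n p) (P.PhiSeq α δ n q) ≤ δ (n + 1) → dist p q < 1 / ((n : ℝ) + 1)
  expansion : ∃ a : ℕ → ℕ, (∀ n, 2 ≤ a n) ∧
    (∃ c : ℝ, 0 < c ∧
      Tendsto (fun N => ∏ r ∈ Finset.Icc 1 N, (1 - 1 / (a r : ℝ))) atTop (𝓝 c)) ∧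
    ∀ n m : ℕ, 1 ≤ n → n < m → ∀ p q : Torus, 1 / (n : ℝ) ≤ dist p q →
      (∏ r ∈ Finset.Icc (n + 1) m, (1 - 1 / (a r : ℝ))) *
          dist (P.PhiSeq α δ n p) (P.PhiSeq α δ n q)
        ≤ dist (P.PhiSeq α δ m p) (P.PhiSeq α δ m q)
  fwd_uniform : ∀ n, UniformContinuousOn (P.fwd α δ n) P.X
  bwd_uniform : ∀ n, UniformContinuousOn (P.bwd α δ n) P.X
  fwd_cauchy : UniformCauchySeqOn (P.fwd α δ) atTop P.X
  bwd_cauchy : UniformCauchySeqOn (P.bwd α δ) atTop P.X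

/-- `S` is the homeomorphism `S_α` built from `δ`: `Φ_α` restricts to a bijection of `X`, and `S`
extends the map `Φ_α⁻¹ ∘ T ∘ Φ_α` of `X`. -/
def IsSystem (S : Torus ≃ₜ Torus) : Prop :=
  BijOn (P.Phi α δ) P.X P.X ∧
    EqOn S (fun p => Function.invFunOn (P.Phi α δ) P.X (P.T (P.Phi α δ p))) P.X

end ReesData

end

/-! Each `Φ_α` is a continuous surjection of the torus that preserves every column, is injective
over `X`, and fails to be injective only over the points `z k`, where it squashes a vertical arc.
Parts (ii) and (iii) both ask to lift a translation by some `w` through such maps: the rotation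
through `Φ_α` on both sides, or the identity through `Φ_α` and `Φ_β`. The lift `H = Φ_β⁻¹ ∘ (· + w)
∘ Φ_α` exists on `X` and has to be extended over the excluded columns.

By compactness it is enough that `H` has a single cluster point at each `p₀`. All cluster points
have the same image `Φ_α p₀ + w`, so they can differ only if this image is some `z k`. There the
collapsed arc carries a coordinate `U`, and in a column at distance `t` the map is `h_t ∘ U` up to
`o(t)`, because the later squares reaching that column have total size `o(t)`. Now `h^β_t` expands
by at least `t/3`, while `h^α_t` and `h^β_t` differ by at most `12 t |p_α(t) - p_β(t)|`, which is
`o(t)` when `α - β` tends to `0`. Dividing by `t` shows that the coordinate of every cluster point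
equals that of `p₀`. `Collapse` isolates the properties used, `Tame.collapse` verifies them, and
`Collapse.chart_limit` is the estimate. Lifts of `w` and `-w` are mutually inverse, which gives
`S_α` and the conjugacy. Minimality passes up from the rotation because `Φ_α` is injective over the
dense set `X`.

For (i) the `δ n` are chosen recursively, each so small that finitely many conditions hold. Finite
stages are collapsing maps too, so the same extension argument gives the uniform continuity in
condition 4; the Cauchy property holds because consecutive stages differ only over a ball with small
preimage (`dist_conj_succ_le`). -/

/-! ### The fibre functions in closed form -/

/-- A closed form of `h^α_t` on `[-1,1]`, with `p = p_α(t)`. -/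
noncomputable def hForm (p t u : ℝ) : ℝ :=
  t * min (-1 / 2 + 3 * (max (-1 / 2) (min u (1 / 2)) + 1 / 2) / (2 - 4 * p))
      (1 / 2 - (1 / 2 - max (-1 / 2) (min u (1 / 2))) / (2 + 4 * p)) +
    (max (u - 1 / 2) 0 + max (u - (1 + t) / 2) 0) -
    (max (-u - 1 / 2) 0 + max (-u - (1 + t) / 2) 0)

theorem hForm_zero_eq_polyline (p : ℝ) {u : ℝ} (hu : u ≤ 1) :
    polyline [(-1, -1), (-1 / 2, 0), (1 / 2, 0), (1, 1)] u = hForm p 0 u := by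
  simp only [polyline, hForm]
  split_ifs with h1 h2
  · rw [max_eq_right (by linarith : u - 1 / 2 ≤ 0), max_eq_right (by linarith : u - (1 + 0) / 2 ≤ 0),
      max_eq_left (by linarith : 0 ≤ -u - 1 / 2), max_eq_left (by linarith : 0 ≤ -u - (1 + 0) / 2)]
    ring
  · rw [max_eq_right (by linarith : u - 1 / 2 ≤ 0), max_eq_right (by linarith : u - (1 + 0) / 2 ≤ 0),
      max_eq_right (by linarith : -u - 1 / 2 ≤ 0), max_eq_right (by linarith : -u - (1 + 0) / 2 ≤ 0)]
    ring
  · rw [max_eq_left (by linarith : 0 ≤ u - 1 / 2), max_eq_left (by linarith : 0 ≤ u - (1 + 0) / 2),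
      max_eq_right (by linarith : -u - 1 / 2 ≤ 0), max_eq_right (by linarith : -u - (1 + 0) / 2 ≤ 0)]
    ring

/-- The two lines under the minimum are the sides meeting at `(-p, t/4)`. The left one is at least
as steep, so the minimum is the polyline on `[-1/2, 1/2]`. The truncated terms add slope 1 beyond
`±1/2` and again beyond `±(1 + t)/2`. -/
theorem hForm_eq_polyline {p t u : ℝ} (hp : |p| ≤ 1 / 4) (ht : 0 < t) (ht1 : t ≤ 1)
    (hu : u ∈ Icc (-1 : ℝ) 1) :
    polyline [(-1, -1), ((-1 - t) / 2, -t), (-1 / 2, -t / 2), (-p, t / 4),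
      (1 / 2, t / 2), ((1 + t) / 2, t), (1, 1)] u = hForm p t u := by
  obtain ⟨hp1, hp2⟩ := abs_le.1 hp
  obtain ⟨hu1, hu2⟩ := hu
  have d1 : 0 < 2 - 4 * p := by linarith
  have d2 : 0 < 2 + 4 * p := by linarith
  have d3 : 0 < -p - -1 / 2 := by linarith
  have d4 : 0 < 1 / 2 - -p := by linarith
  simp only [polyline, hForm]
  split_ifs with h1 h2 h3 h4 h5
  · rw [max_eq_right (by linarith : u - 1 / 2 ≤ 0), max_eq_right (by linarith : u - (1 + t) / 2 ≤ 0),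
      max_eq_left (by linarith : 0 ≤ -u - 1 / 2), max_eq_left (by linarith : 0 ≤ -u - (1 + t) / 2),
      min_eq_left (by linarith : u ≤ 1 / 2), max_eq_left (by linarith : u ≤ -1 / 2), min_eq_left]
    -- For `t = 1` the first two nodes have the same abscissa and this case contains only `u = -1`.
    · rcases ht1.eq_or_lt with rfl | ht1
      · have : u = -1 := by linarith
        subst this
        norm_num
      · have : (-1 - t) / 2 - -1 ≠ 0 := by linarith
        have e : (-t - -1) / ((-1 - t) / 2 - -1) = 2 := by
          rw [div_eq_iff this]; ring
        rw [e]
        field_simp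
        ring
    · have : (1 / 2 - (-1 : ℝ) / 2) / (2 + 4 * p) ≤ 1 := by
        rw [div_le_iff₀ d2]; linarith
      norm_num at this ⊢
      linarith
  · rw [max_eq_right (by linarith : u - 1 / 2 ≤ 0), max_eq_right (by linarith : u - (1 + t) / 2 ≤ 0),
      max_eq_left (by linarith : 0 ≤ -u - 1 / 2), max_eq_right (by linarith : -u - (1 + t) / 2 ≤ 0),
      min_eq_left (by linarith : u ≤ 1 / 2), max_eq_left (by linarith : u ≤ -1 / 2), min_eq_left]
    · have : -1 / 2 - (-1 - t) / 2 ≠ 0 := by linarith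
      have e : (-t / 2 - -t) / (-1 / 2 - (-1 - t) / 2) = 1 := by
        rw [div_eq_one_iff_eq this]; ring
      rw [e]
      ring
    · have : (1 / 2 - (-1 : ℝ) / 2) / (2 + 4 * p) ≤ 1 := by
        rw [div_le_iff₀ d2]; linarith
      norm_num at this ⊢
      linarith
  · rw [max_eq_right (by linarith : u - 1 / 2 ≤ 0), max_eq_right (by linarith : u - (1 + t) / 2 ≤ 0),
      max_eq_right (by linarith : -u - 1 / 2 ≤ 0), max_eq_right (by linarith : -u - (1 + t) / 2 ≤ 0),
      min_eq_left (by linarith : u ≤ 1 / 2), max_eq_right (by linarith : -1 / 2 ≤ u), min_eq_left]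
    · have e : -p - -1 / 2 = (2 - 4 * p) / 4 := by ring
      rw [e]
      field_simp
      ring
    · have a1 : 3 * (u + 1 / 2) / (2 - 4 * p) ≤ 3 / 4 := by
        rw [div_le_iff₀ d1]; linarith
      have a2 : (1 / 2 - u) / (2 + 4 * p) = 1 / 4 + (-p - u) / (2 + 4 * p) := by field_simp; ring
      have a3 : 3 * (u + 1 / 2) / (2 - 4 * p) = 3 / 4 - 3 * (-p - u) / (2 - 4 * p) := by
        field_simp; ring
      have a4 : (-p - u) / (2 + 4 * p) ≤ 3 * (-p - u) / (2 - 4 * p) := by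
        rw [div_le_div_iff₀ d2 d1]
        nlinarith
      rw [a2, a3]; linarith
  · rw [max_eq_right (by linarith : u - 1 / 2 ≤ 0), max_eq_right (by linarith : u - (1 + t) / 2 ≤ 0),
      max_eq_right (by linarith : -u - 1 / 2 ≤ 0), max_eq_right (by linarith : -u - (1 + t) / 2 ≤ 0),
      min_eq_left (by linarith : u ≤ 1 / 2), max_eq_right (by linarith : -1 / 2 ≤ u), min_eq_right]
    · have e : 1 / 2 - -p = (2 + 4 * p) / 4 := by ring
      rw [e]
      field_simp
      ring
    · have a2 : (1 / 2 - u) / (2 + 4 * p) = 1 / 4 - (u + p) / (2 + 4 * p) := by field_simp; ring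
      have a3 : 3 * (u + 1 / 2) / (2 - 4 * p) = 3 / 4 + 3 * (u + p) / (2 - 4 * p) := by
        field_simp; ring
      have a4 : (u + p) / (2 + 4 * p) ≤ 3 * (u + p) / (2 - 4 * p) := by
        rw [div_le_div_iff₀ d2 d1]
        nlinarith
      rw [a2, a3]; linarith
  · rw [max_eq_left (by linarith : 0 ≤ u - 1 / 2), max_eq_right (by linarith : u - (1 + t) / 2 ≤ 0),
      max_eq_right (by linarith : -u - 1 / 2 ≤ 0), max_eq_right (by linarith : -u - (1 + t) / 2 ≤ 0),
      min_eq_right (by linarith : 1 / 2 ≤ u), max_eq_right (by linarith : (-1 : ℝ) / 2 ≤ 1 / 2),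
      min_eq_right]
    · have : (1 + t) / 2 - 1 / 2 ≠ 0 := by linarith
      have e : (t - t / 2) / ((1 + t) / 2 - 1 / 2) = 1 := by
        rw [div_eq_one_iff_eq this]; ring
      rw [e]
      ring
    · have : (1 : ℝ) ≤ 3 * (1 / 2 + 1 / 2) / (2 - 4 * p) := by
        rw [le_div_iff₀ d1]; linarith
      rw [sub_self, zero_div]
      linarith
  · rw [max_eq_left (by linarith : 0 ≤ u - 1 / 2), max_eq_left (by linarith : 0 ≤ u - (1 + t) / 2),
      max_eq_right (by linarith : -u - 1 / 2 ≤ 0), max_eq_right (by linarith : -u - (1 + t) / 2 ≤ 0),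
      min_eq_right (by linarith : 1 / 2 ≤ u), max_eq_right (by linarith : (-1 : ℝ) / 2 ≤ 1 / 2),
      min_eq_right]
    · have : 1 - (1 + t) / 2 ≠ 0 := by linarith
      have e : (1 - t) / (1 - (1 + t) / 2) = 2 := by
        rw [div_eq_iff this]; ring
      rw [e]
      ring
    · have : (1 : ℝ) ≤ 3 * (1 / 2 + 1 / 2) / (2 - 4 * p) := by
        rw [le_div_iff₀ d1]; linarith
      rw [sub_self, zero_div]
      linarith

theorem clamp_mono {u v : ℝ} (h : u ≤ v) :
    max (-1 / 2) (min u (1 / 2)) ≤ max (-1 / 2) (min v (1 / 2)) := by gcongr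

theorem clamp_mem (u : ℝ) : max (-1 / 2) (min u (1 / 2)) ∈ Icc (-1 / 2 : ℝ) (1 / 2) :=
  ⟨le_max_left _ _, max_le (by norm_num) (min_le_right _ _)⟩

/-- The increments of the outer part of `hForm` dominate those of `u - clamp u`. -/
theorem outer_increment {t u v : ℝ} (huv : u ≤ v) :
    (v - u) - (max (-1 / 2) (min v (1 / 2)) - max (-1 / 2) (min u (1 / 2))) ≤
      ((max (v - 1 / 2) 0 + max (v - (1 + t) / 2) 0) -
        (max (-v - 1 / 2) 0 + max (-v - (1 + t) / 2) 0)) -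
      ((max (u - 1 / 2) 0 + max (u - (1 + t) / 2) 0) -
        (max (-u - 1 / 2) 0 + max (-u - (1 + t) / 2) 0)) := by
  have key : ∀ w : ℝ, w = max (-1 / 2) (min w (1 / 2)) + max (w - 1 / 2) 0 - max (-w - 1 / 2) 0 := by
    intro w
    grind
  have a : max (u - (1 + t) / 2) 0 ≤ max (v - (1 + t) / 2) 0 := by gcongr
  have b : max (-v - (1 + t) / 2) 0 ≤ max (-u - (1 + t) / 2) 0 := by gcongr
  linarith [key u, key v]

/-- The middle slopes `3t/(2 - 4p)` and `t/(2 + 4p)` are at least `t/3` because `|p| ≤ 1/4`, and the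
outer slopes are at least 1. -/
theorem hForm_increment {p t u v : ℝ} (hp : |p| ≤ 1 / 4) (ht : 0 ≤ t) (ht1 : t ≤ 1) (huv : u ≤ v) :
    t / 3 * (v - u) ≤ hForm p t v - hForm p t u := by
  obtain ⟨hp1, hp2⟩ := abs_le.1 hp
  have d1 : 0 < 2 - 4 * p := by linarith
  have d2 : 0 < 2 + 4 * p := by linarith
  have o := outer_increment (t := t) huv
  have c := clamp_mono huv
  unfold hForm
  set cu := max (-1 / 2) (min u (1 / 2))
  set cv := max (-1 / 2) (min v (1 / 2))
  have m : (cv - cu) / 3 ≤ min (-1 / 2 + 3 * (cv + 1 / 2) / (2 - 4 * p))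
        (1 / 2 - (1 / 2 - cv) / (2 + 4 * p)) - min (-1 / 2 + 3 * (cu + 1 / 2) / (2 - 4 * p))
        (1 / 2 - (1 / 2 - cu) / (2 + 4 * p)) := by
    have l : 3 * (cv + 1 / 2) / (2 - 4 * p) - 3 * (cu + 1 / 2) / (2 - 4 * p) ≥ (cv - cu) / 3 := by
      rw [← sub_div, ge_iff_le, div_le_div_iff₀ (by norm_num) d1]
      nlinarith
    have r : (1 / 2 - cu) / (2 + 4 * p) - (1 / 2 - cv) / (2 + 4 * p) ≥ (cv - cu) / 3 := by
      rw [← sub_div, ge_iff_le, div_le_div_iff₀ (by norm_num) d2]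
      nlinarith
    rcases min_choice (-1 / 2 + 3 * (cv + 1 / 2) / (2 - 4 * p))
        (1 / 2 - (1 / 2 - cv) / (2 + 4 * p)) with e | e <;> rw [e]
    · linarith [min_le_left (-1 / 2 + 3 * (cu + 1 / 2) / (2 - 4 * p))
        (1 / 2 - (1 / 2 - cu) / (2 + 4 * p))]
    · linarith [min_le_right (-1 / 2 + 3 * (cu + 1 / 2) / (2 - 4 * p))
        (1 / 2 - (1 / 2 - cu) / (2 + 4 * p))]
  have m' := mul_le_mul_of_nonneg_left m ht
  have cc : cv - cu ≤ v - u := by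
    simp only [cu, cv]
    grind
  nlinarith

/-- Only the middle factor depends on `p`, and it is multiplied by `t`. The denominators `2 ± 4p`
are at least 1, which bounds the Lipschitz constants of the two lines by 12 and 4. -/
theorem abs_hForm_sub_le {p p' t u : ℝ} (hp : |p| ≤ 1 / 4) (hp' : |p'| ≤ 1 / 4) (ht : 0 ≤ t) :
    |hForm p t u - hForm p' t u| ≤ 12 * t * |p - p'| := by
  obtain ⟨hp1, hp2⟩ := abs_le.1 hp
  obtain ⟨hp1', hp2'⟩ := abs_le.1 hp'
  have d1 : 0 < 2 - 4 * p := by linarith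
  have d2 : 0 < 2 + 4 * p := by linarith
  have d1' : 0 < 2 - 4 * p' := by linarith
  have d2' : 0 < 2 + 4 * p' := by linarith
  obtain ⟨c1, c2⟩ := clamp_mem u
  unfold hForm
  set c := max (-1 / 2) (min u (1 / 2))
  rw [show ∀ a b x y : ℝ, t * a + x - y - (t * b + x - y) = t * (a - b) by intros; ring, abs_mul,
    abs_of_nonneg ht]
  have : |min (-1 / 2 + 3 * (c + 1 / 2) / (2 - 4 * p)) (1 / 2 - (1 / 2 - c) / (2 + 4 * p)) -
      min (-1 / 2 + 3 * (c + 1 / 2) / (2 - 4 * p')) (1 / 2 - (1 / 2 - c) / (2 + 4 * p'))| ≤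
      12 * |p - p'| := by
    refine (abs_min_sub_min_le_max _ _ _ _).trans (max_le ?_ ?_)
    · rw [show -1 / 2 + 3 * (c + 1 / 2) / (2 - 4 * p) - (-1 / 2 + 3 * (c + 1 / 2) / (2 - 4 * p')) =
        (12 * (c + 1 / 2) / ((2 - 4 * p) * (2 - 4 * p'))) * (p - p') by field_simp; ring, abs_mul]
      gcongr
      rw [abs_of_nonneg (div_nonneg (by linarith) (mul_pos d1 d1').le), div_le_iff₀ (by positivity)]
      nlinarith
    · rw [show 1 / 2 - (1 / 2 - c) / (2 + 4 * p) - (1 / 2 - (1 / 2 - c) / (2 + 4 * p')) =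
        (4 * (1 / 2 - c) / ((2 + 4 * p) * (2 + 4 * p'))) * (p - p') by field_simp; ring, abs_mul]
      gcongr
      rw [abs_of_nonneg (div_nonneg (by linarith) (mul_pos d2 d2').le), div_le_iff₀ (by positivity)]
      nlinarith
  nlinarith

/-- The outer nodes `±((1 + t)/2, t)` all lie on the lines with slope 2 through `±(1, 1)`, so these
values do not depend on `t ≤ c`. This is what makes `Lam` the identity on the horizontal sides of
its square. -/
theorem hForm_outer {p t c : ℝ} (hp : |p| ≤ 1 / 4) (ht : 0 ≤ t) (htc : t ≤ c) :
    hForm p t ((1 + c) / 2) = c ∧ hForm p t (-((1 + c) / 2)) = -c := by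
  obtain ⟨hp1, hp2⟩ := abs_le.1 hp
  have d1 : 0 < 2 - 4 * p := by linarith
  have d2 : 0 < 2 + 4 * p := by linarith
  constructor
  · unfold hForm
    rw [max_eq_left (by linarith : 0 ≤ (1 + c) / 2 - 1 / 2),
      max_eq_left (by linarith : 0 ≤ (1 + c) / 2 - (1 + t) / 2),
      max_eq_right (by linarith : -((1 + c) / 2) - 1 / 2 ≤ 0),
      max_eq_right (by linarith : -((1 + c) / 2) - (1 + t) / 2 ≤ 0),
      min_eq_right (by linarith : 1 / 2 ≤ (1 + c) / 2),
      max_eq_right (by linarith : (-1 : ℝ) / 2 ≤ 1 / 2), min_eq_right]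
    · ring
    · have : (1 : ℝ) ≤ 3 * (1 / 2 + 1 / 2) / (2 - 4 * p) := by
        rw [le_div_iff₀ d1]; linarith
      rw [sub_self, zero_div]
      linarith
  · unfold hForm
    rw [max_eq_right (by linarith : -((1 + c) / 2) - 1 / 2 ≤ 0),
      max_eq_right (by linarith : -((1 + c) / 2) - (1 + t) / 2 ≤ 0),
      max_eq_left (by linarith : 0 ≤ - -((1 + c) / 2) - 1 / 2),
      max_eq_left (by linarith : 0 ≤ - -((1 + c) / 2) - (1 + t) / 2),
      min_eq_left (by linarith : -((1 + c) / 2) ≤ 1 / 2),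
      max_eq_left (by linarith : -((1 + c) / 2) ≤ -1 / 2), min_eq_left]
    · field_simp; ring
    · have : (1 / 2 - (-1 : ℝ) / 2) / (2 + 4 * p) ≤ 1 := by
        rw [div_le_iff₀ d2]; linarith
      norm_num at this ⊢
      linarith

theorem hForm_zero_inj {p u v : ℝ} (huv : hForm p 0 u = hForm p 0 v) :
    u = v ∨ hForm p 0 u = 0 := by
  unfold hForm at *
  grind

theorem hForm_zero_eq_zero {p u : ℝ} (hu : hForm p 0 u = 0) : |u| ≤ 1 / 2 := by
  unfold hForm at *
  grind

/-- The middle factor of `hForm`. -/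
theorem abs_hForm_mid_le {p : ℝ} (hp : |p| ≤ 1 / 4) (u : ℝ) :
    |min (-1 / 2 + 3 * (max (-1 / 2) (min u (1 / 2)) + 1 / 2) / (2 - 4 * p))
      (1 / 2 - (1 / 2 - max (-1 / 2) (min u (1 / 2))) / (2 + 4 * p))| ≤ 1 / 2 := by
  obtain ⟨hp1, hp2⟩ := abs_le.1 hp
  have d1 : 0 < 2 - 4 * p := by linarith
  have d2 : 0 < 2 + 4 * p := by linarith
  obtain ⟨c1, c2⟩ := clamp_mem u
  set c := max (-1 / 2) (min u (1 / 2))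
  have a : 0 ≤ 3 * (c + 1 / 2) / (2 - 4 * p) := div_nonneg (by linarith) d1.le
  have b : 0 ≤ (1 / 2 - c) / (2 + 4 * p) := div_nonneg (by linarith) d2.le
  have b' : (1 / 2 - c) / (2 + 4 * p) ≤ 1 := by rw [div_le_one d2]; linarith
  rw [abs_le]
  exact ⟨le_min (by linarith) (by linarith), (min_le_right _ _).trans (by linarith)⟩

/-- `p_α` may oscillate as `t → 0`, but it enters only through a factor bounded by `1/2` and
multiplied by `t`; hence continuity of `f` is needed only where `t ≠ 0`. -/
theorem hForm_continuousWithinAt {f : ℝ → ℝ} (hf : ∀ t, |f t| ≤ 1 / 4) {s : Set (ℝ × ℝ)} {x : ℝ × ℝ}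
    (hc : x.1 ≠ 0 → ContinuousWithinAt (fun y : ℝ × ℝ => f |y.1|) s x) :
    ContinuousWithinAt (fun y : ℝ × ℝ => hForm (f |y.1|) |y.1| y.2) s x := by
  unfold hForm
  refine ContinuousWithinAt.sub (ContinuousWithinAt.add ?_ ?_) ?_
  · by_cases hx : x.1 = 0
    · rw [ContinuousWithinAt]
      simp only [hx, abs_zero, zero_mul]
      refine squeeze_zero_norm (a := fun y : ℝ × ℝ => |y.1| * (1 / 2)) ?_ ?_
      · intro y
        rw [Real.norm_eq_abs, abs_mul, abs_abs]
        gcongr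
        exact abs_hForm_mid_le (hf _) _
      · have : Continuous fun y : ℝ × ℝ => |y.1| * (1 / 2) := by fun_prop
        simpa [hx] using (this.tendsto x).mono_left nhdsWithin_le_nhds
    · have hc := hc hx
      obtain ⟨hp1, hp2⟩ := abs_le.1 (hf |x.1|)
      have c2 : ContinuousWithinAt (fun y : ℝ × ℝ => max (-1 / 2) (min y.2 (1 / 2))) s x := by
        fun_prop
      refine ContinuousWithinAt.mul (by fun_prop) (Tendsto.min ?_ ?_)
      · exact continuousWithinAt_const.add (((continuousWithinAt_const.mul
          (c2.add continuousWithinAt_const))).div (continuousWithinAt_const.sub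
          (continuousWithinAt_const.mul hc)) (by linarith))
      · exact continuousWithinAt_const.sub (((continuousWithinAt_const.sub c2)).div
          (continuousWithinAt_const.add (continuousWithinAt_const.mul hc)) (by linarith))
  · fun_prop
  · fun_prop

/-! ### Polylines -/

theorem polyline_head (p : ℝ × ℝ) (l : List (ℝ × ℝ))
    (hl : (p :: l).IsChain (fun a b => a.1 < b.1)) : polyline (p :: l) p.1 = p.2 := by
  cases l with
  | nil => rfl
  | cons q l =>
    rw [List.isChain_cons_cons] at hl
    simp [polyline, hl.1.le]

theorem continuous_polyline (l : List (ℝ × ℝ)) (hl : l.IsChain (fun a b => a.1 < b.1)) :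
    Continuous (polyline l) := by
  induction l with
  | nil => exact continuous_const
  | cons p l ih =>
    cases l with
    | nil => exact continuous_const
    | cons q l =>
      rw [List.isChain_cons_cons] at hl
      have h0 : q.1 - p.1 ≠ 0 := by linarith [hl.1]
      refine Continuous.if_le (by fun_prop) (ih hl.2) continuous_id continuous_const ?_
      rintro s rfl
      rw [polyline_head q l hl.2, div_mul_cancel₀ _ h0]
      ring

theorem polyline_mem_Icc {a b : ℝ} (l : List (ℝ × ℝ)) (hl : l.IsChain (fun a b => a.1 < b.1))
    (hne : l ≠ []) (hv : ∀ p ∈ l, p.2 ∈ Icc a b) (s : ℝ) (hs : ∀ p ∈ l.head?, p.1 ≤ s) :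
    polyline l s ∈ Icc a b := by
  induction l with
  | nil => exact absurd rfl hne
  | cons p l ih =>
    cases l with
    | nil => exact hv p (by simp)
    | cons q l =>
      rw [List.isChain_cons_cons] at hl
      simp only [polyline]
      split_ifs with h
      · have hp := hv p (by simp)
        have hq := hv q (by simp)
        have hps : p.1 ≤ s := hs p (by simp)
        have d : 0 < q.1 - p.1 := by linarith [hl.1]
        have e : p.2 + (q.2 - p.2) / (q.1 - p.1) * (s - p.1) =
            p.2 + ((s - p.1) / (q.1 - p.1)) • (q.2 - p.2) := by
          rw [smul_eq_mul]; ring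
        rw [e]
        exact (convex_Icc a b).add_smul_sub_mem hp hq
          ⟨div_nonneg (by linarith) d.le, (div_le_one d).2 (by linarith)⟩
      · exact ih hl.2 (by simp) (fun r hr => hv r (List.mem_cons_of_mem _ hr)) (by
          simp only [List.head?_cons, Option.mem_some_iff]
          rintro r rfl
          linarith)

theorem polyline_sub (L : List (ℝ × ℝ × ℝ)) (s : ℝ) :
    polyline (L.map fun x => (x.1, x.2.1)) s - polyline (L.map fun x => (x.1, x.2.2)) s =
      polyline (L.map fun x => (x.1, x.2.1 - x.2.2)) s := by
  induction L with
  | nil => simp [polyline]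
  | cons p L ih =>
    cases L with
    | nil => simp [polyline]
    | cons q L =>
      simp only [List.map_cons, polyline] at ih ⊢
      split_ifs with h
      · ring
      · exact ih

/-! ### The function `p_α` and the resulting estimates for `h` -/

namespace ReesData

variable (P : ReesData) (α β : ℕ → unitInterval)

theorem ε_succ_lt (k : ℕ) : P.ε (k + 1) < P.ε k :=
  (P.ε_lt_e₁ k).trans ((P.e₁_lt_e₂ k).trans ((P.e₂_lt_e₃ k).trans (P.e₃_lt_ε k)))

theorem ε_strictAnti : StrictAnti P.ε := strictAnti_nat_of_succ_lt P.ε_succ_lt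

theorem level_spec {t : ℝ} (ht : 0 < t) : P.ε (P.level t + 1) ≤ t := by
  have : {k | P.ε (k + 1) ≤ t}.Nonempty := by
    have := (P.ε_tendsto.comp (tendsto_add_atTop_nat 1)).eventually (gt_mem_nhds ht)
    obtain ⟨k, hk⟩ := this.exists
    exact ⟨k, le_of_lt hk⟩
  exact Nat.sInf_mem this

/-- The nodes of the graphs of `p_α` and `p_β` over `[ε (k+1), ε k]`. -/
noncomputable def nodes (k : ℕ) : List (ℝ × ℝ × ℝ) :=
  [(P.ε (k + 1), P.q k / 4, P.q k / 4), (P.e₁ k, P.q k / 4, P.q k / 4),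
    (P.e₂ k, α k / 4, β k / 4), (P.e₃ k, α k / 4, β k / 4),
    (P.ε k, (if k = 0 then -1 / 4 else P.q (k - 1) / 4),
      (if k = 0 then -1 / 4 else P.q (k - 1) / 4))]

theorem pFun_eq_left (t : ℝ) :
    P.pFun α t = polyline ((P.nodes α β (P.level t)).map fun x => (x.1, x.2.1)) t := rfl

theorem pFun_eq_right (t : ℝ) :
    P.pFun β t = polyline ((P.nodes α β (P.level t)).map fun x => (x.1, x.2.2)) t := rfl

theorem nodes_chain (f : ℝ × ℝ × ℝ → ℝ) (k : ℕ) :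
    ((P.nodes α β k).map fun x => (x.1, f x)).IsChain (fun a b => a.1 < b.1) := by
  simp [nodes, P.ε_lt_e₁ k, P.e₁_lt_e₂ k, P.e₂_lt_e₃ k, P.e₃_lt_ε k]

theorem pFun_mem {t : ℝ} (ht : 0 < t) : |P.pFun α t| ≤ 1 / 4 := by
  rw [abs_le, ← mem_Icc, P.pFun_eq_left α α]
  refine polyline_mem_Icc _ (P.nodes_chain α α (fun x => x.2.1) _) (by simp [nodes]) ?_ t ?_
  · have h1 := fun k => (α k).2
    have h2 := P.q_mem
    simp only [mem_Icc] at h1 h2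
    simp only [nodes, List.map_cons, List.map_nil, List.mem_cons, List.not_mem_nil, or_false, mem_Icc]
    set k := P.level t
    rintro p (rfl | rfl | rfl | rfl | rfl)
    · constructor <;> linarith [(h2 k).1, (h2 k).2]
    · constructor <;> linarith [(h2 k).1, (h2 k).2]
    · constructor <;> linarith [(h1 k).1, (h1 k).2]
    · constructor <;> linarith [(h1 k).1, (h1 k).2]
    · dsimp only
      split_ifs
      · norm_num
      · constructor <;> linarith [(h2 (k - 1)).1, (h2 (k - 1)).2]
  · simpa [nodes] using P.level_spec ht

/-- Both functions have the same abscissas on a piece, so their difference is a polyline whose node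
values are `0` or `(α k - β k) / 4`. -/
theorem abs_pFun_sub_le {t : ℝ} (ht : 0 < t) :
    |P.pFun α t - P.pFun β t| ≤ |(α (P.level t) : ℝ) - β (P.level t)| := by
  rw [abs_le, ← mem_Icc, P.pFun_eq_left α β, P.pFun_eq_right α β, polyline_sub]
  refine polyline_mem_Icc _ (P.nodes_chain α β (fun x => x.2.1 - x.2.2) _) (by simp [nodes]) ?_ t ?_
  · set k := P.level t
    have h : (α k / 4 - β k / 4 : ℝ) ∈ Icc (-|(α k : ℝ) - β k|) |(α k : ℝ) - β k| := by
      constructor <;>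
        linarith [le_abs_self ((α k : ℝ) - β k), neg_abs_le ((α k : ℝ) - β k),
          abs_nonneg ((α k : ℝ) - β k)]
    have h0 : (0 : ℝ) ∈ Icc (-|(α k : ℝ) - β k|) |(α k : ℝ) - β k| := by simp
    simp only [nodes, List.map_cons, List.map_nil, List.mem_cons, List.not_mem_nil, or_false]
    rintro p (rfl | rfl | rfl | rfl | rfl)
    · simpa only [sub_self] using h0
    · simpa only [sub_self] using h0
    · exact h
    · exact h
    · simpa only [sub_self] using h0
  · simpa [nodes] using P.level_spec ht

theorem tendsto_level : Tendsto P.level (𝓝[>] 0) atTop := by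
  rw [tendsto_atTop]
  intro k
  have : Iio (P.ε k) ∈ 𝓝[>] (0 : ℝ) := nhdsWithin_le_nhds (Iio_mem_nhds (P.ε_pos k))
  filter_upwards [this, self_mem_nhdsWithin] with t ht ht0
  by_contra! hlt
  exact absurd ((P.ε_strictAnti.antitone hlt).trans (P.level_spec ht0)) (not_le.2 ht)

theorem tendsto_pFun_sub (h : C0Rel α β) :
    Tendsto (fun t => |P.pFun α t - P.pFun β t|) (𝓝[>] 0) (𝓝 0) := by
  refine squeeze_zero' (Eventually.of_forall fun _ => abs_nonneg _) ?_ (h.comp P.tendsto_level)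
  filter_upwards [self_mem_nhdsWithin] with t ht using P.abs_pFun_sub_le α β ht

/-- For `k ≥ 1`, `level` assigns the right end point `ε k` to the piece `k - 1`. The point is that
both formulas give `q (k - 1) / 4` there, so that the pieces can be glued. -/
theorem pFun_eqOn_piece (k : ℕ) : EqOn (P.pFun α)
    (polyline ((P.nodes α α k).map fun x => (x.1, x.2.1))) (Icc (P.ε (k + 1)) (P.ε k)) := by
  intro t ⟨h1, h2⟩
  have ht : 0 < t := (P.ε_pos _).trans_le h1
  have hle : P.level t ≤ k := Nat.sInf_le h1
  rcases hle.eq_or_lt with e | hlt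
  · rw [P.pFun_eq_left α α, e]
  · have ht' : t = P.ε k :=
      h2.antisymm ((P.ε_strictAnti.antitone (Nat.succ_le_of_lt hlt)).trans (P.level_spec ht))
    have hk : P.level t + 1 = k := by
      refine le_antisymm hlt (P.ε_strictAnti.le_iff_ge.1 ?_)
      rw [← ht']
      exact P.level_spec ht
    have l : P.pFun α t = P.q (P.level t) / 4 := by
      rw [P.pFun_eq_left α α]
      have := polyline_head (P.ε (P.level t + 1), P.q (P.level t) / 4) _
        (P.nodes_chain α α (fun x => x.2.1) (P.level t))
      rw [hk, ← ht'] at this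
      simpa only [nodes, List.map_cons, hk, ← ht'] using this
    have hk0 : k ≠ 0 := by omega
    have hk1 : k - 1 = P.level t := by omega
    rw [l, ht']
    have c1 := P.ε_lt_e₁ k
    have c2 := P.e₁_lt_e₂ k
    have c3 := P.e₂_lt_e₃ k
    have c4 := P.e₃_lt_ε k
    have d : P.ε k - P.e₃ k ≠ 0 := by linarith
    simp only [nodes, List.map_cons, List.map_nil, polyline]
    rw [if_neg (by linarith), if_neg (by linarith), if_neg (by linarith), if_pos le_rfl,
      if_neg hk0, hk1, div_mul_cancel₀ _ d, ← ht']
    ring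

theorem continuousOn_pFun_Icc (n : ℕ) : ContinuousOn (P.pFun α) (Icc (P.ε n) 1) := by
  induction n with
  | zero => rw [P.ε_zero, Icc_self]; exact continuousOn_singleton _ _
  | succ n ih =>
    have hu : Icc (P.ε (n + 1)) 1 = Icc (P.ε (n + 1)) (P.ε n) ∪ Icc (P.ε n) 1 := by
      rw [Icc_union_Icc_eq_Icc (P.ε_succ_lt n).le]
      rw [← P.ε_zero]
      exact P.ε_strictAnti.antitone (Nat.zero_le n)
    rw [hu]
    refine ContinuousOn.union_of_isClosed ?_ ih isClosed_Icc isClosed_Icc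
    exact (continuous_polyline _ (P.nodes_chain α α (fun x => x.2.1) n)).continuousOn.congr
      (P.pFun_eqOn_piece α n)

theorem continuousOn_pFun : ContinuousOn (P.pFun α) (Ioc 0 1) := by
  intro t ht
  obtain ⟨n, hn⟩ := (P.ε_tendsto.eventually (gt_mem_nhds ht.1)).exists
  refine ((P.continuousOn_pFun_Icc α n) t ⟨le_of_lt hn, ht.2⟩).mono_of_mem_nhdsWithin ?_
  filter_upwards [self_mem_nhdsWithin, nhdsWithin_le_nhds (Ioi_mem_nhds hn)] with s hs hs'
  exact ⟨le_of_lt hs', hs.2⟩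

/-- `p_α`, cut off to `[-1/4, 1/4]` outside of its domain. -/
noncomputable def pCut (t : ℝ) : ℝ := max (-(1 / 4)) (min (P.pFun α t) (1 / 4))

theorem abs_pCut_le (t : ℝ) : |P.pCut α t| ≤ 1 / 4 :=
  abs_le.2 ⟨le_max_left _ _, max_le (by norm_num) (min_le_right _ _)⟩

theorem pCut_eq {t : ℝ} (ht : 0 < t) : P.pCut α t = P.pFun α t := by
  have := abs_le.1 (P.pFun_mem α ht)
  rw [pCut, min_eq_left this.2, max_eq_right this.1]

theorem h_eq_hForm {t u : ℝ} (ht : |t| ≤ 1) (hu : u ∈ Icc (-1 : ℝ) 1) :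
    P.h α t u = hForm (P.pCut α |t|) |t| u := by
  unfold h
  split_ifs with h0
  · rw [h0, abs_zero, ← hForm_zero_eq_polyline _ hu.2]
  · rw [P.pCut_eq α (abs_pos.2 h0)]
    exact hForm_eq_polyline (P.pFun_mem α (abs_pos.2 h0)) (abs_pos.2 h0) ht hu

theorem continuousOn_h : ContinuousOn (fun x : ℝ × ℝ => P.h α x.1 x.2)
    (Icc (-1) 1 ×ˢ Icc (-1) 1) := by
  have : ContinuousOn (fun x : ℝ × ℝ => hForm (P.pCut α |x.1|) |x.1| x.2)
      (Icc (-1) 1 ×ˢ Icc (-1) 1) := by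
    intro x hx
    refine hForm_continuousWithinAt (P.abs_pCut_le α) fun h0 => ?_
    have hc : ContinuousOn (P.pCut α) (Ioc 0 1) := by
      have := P.continuousOn_pFun α
      unfold pCut
      fun_prop
    have hx1 : |x.1| ∈ Ioc (0 : ℝ) 1 := ⟨abs_pos.2 h0, abs_le.2 hx.1⟩
    have hn : {y : ℝ × ℝ | y.1 ≠ 0} ∈ 𝓝 x := continuous_fst.continuousAt.eventually_ne h0
    have hcomp : ContinuousWithinAt (P.pCut α ∘ fun y : ℝ × ℝ => |y.1|)
        ((Icc (-1 : ℝ) 1 ×ˢ Icc (-1 : ℝ) 1) ∩ {y : ℝ × ℝ | y.1 ≠ 0}) x :=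
      ContinuousWithinAt.comp (t := Ioc 0 1) (hc _ hx1) (by fun_prop)
        fun y hy => ⟨abs_pos.2 hy.2, abs_le.2 hy.1.1⟩
    exact hcomp.mono_of_mem_nhdsWithin (inter_mem_nhdsWithin _ hn)
  exact this.congr fun x hx => P.h_eq_hForm α (abs_le.2 hx.1) hx.2

theorem h_increment {t u v : ℝ} (ht : |t| ≤ 1) (hu : u ∈ Icc (-1 : ℝ) 1)
    (hv : v ∈ Icc (-1 : ℝ) 1) : |t| / 3 * |u - v| ≤ |P.h α t u - P.h α t v| := by
  rw [P.h_eq_hForm α ht hu, P.h_eq_hForm α ht hv]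
  rcases le_total u v with huv | huv
  · rw [abs_sub_comm, abs_of_nonneg (sub_nonneg.2 huv), abs_sub_comm]
    exact (hForm_increment (P.abs_pCut_le α _) (abs_nonneg t) ht huv).trans (le_abs_self _)
  · rw [abs_of_nonneg (sub_nonneg.2 huv)]
    exact (hForm_increment (P.abs_pCut_le α _) (abs_nonneg t) ht huv).trans (le_abs_self _)

theorem monotoneOn_h {t : ℝ} (ht : |t| ≤ 1) : MonotoneOn (P.h α t) (Icc (-1) 1) := by
  intro u hu v hv huv
  rw [P.h_eq_hForm α ht hu, P.h_eq_hForm α ht hv]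
  have := hForm_increment (P.abs_pCut_le α |t|) (abs_nonneg t) ht huv
  have : 0 ≤ |t| / 3 * (v - u) := mul_nonneg (by positivity) (sub_nonneg.2 huv)
  linarith

theorem injOn_h {t : ℝ} (ht : |t| ≤ 1) (h0 : t ≠ 0) : InjOn (P.h α t) (Icc (-1) 1) := by
  intro u hu v hv huv
  have := P.h_increment α ht hu hv
  rw [huv, sub_self, abs_zero] at this
  have hp : 0 < |t| / 3 := by positivity
  have : |u - v| ≤ 0 := by nlinarith [abs_nonneg (u - v)]
  exact sub_eq_zero.1 (abs_nonpos_iff.1 this)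

theorem abs_h_sub_le {t u : ℝ} (ht : |t| ≤ 1) (h0 : t ≠ 0) (hu : u ∈ Icc (-1 : ℝ) 1) :
    |P.h α t u - P.h β t u| ≤ 12 * |t| * |P.pFun α (|t|) - P.pFun β (|t|)| := by
  rw [P.h_eq_hForm α ht hu, P.h_eq_hForm β ht hu, ← P.pCut_eq α (abs_pos.2 h0),
    ← P.pCut_eq β (abs_pos.2 h0)]
  exact abs_hForm_sub_le (P.abs_pCut_le α _) (P.abs_pCut_le β _) (abs_nonneg _)

theorem h_outer {t c : ℝ} (hc : |t| ≤ c) (hc1 : c ≤ 1) :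
    P.h α t ((1 + c) / 2) = c ∧ P.h α t (-((1 + c) / 2)) = -c := by
  have h0 := abs_nonneg t
  rw [P.h_eq_hForm α (hc.trans hc1) ⟨by linarith, by linarith⟩,
    P.h_eq_hForm α (hc.trans hc1) ⟨by linarith, by linarith⟩]
  exact hForm_outer (P.abs_pCut_le α _) (abs_nonneg t) hc

theorem h_zero_inj {u v : ℝ} (hu : u ∈ Icc (-1 : ℝ) 1) (hv : v ∈ Icc (-1 : ℝ) 1)
    (huv : P.h α 0 u = P.h α 0 v) : u = v ∨ P.h α 0 u = 0 := by
  rw [P.h_eq_hForm α (by simp) hu] at huv ⊢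
  rw [P.h_eq_hForm α (by simp) hv, abs_zero] at huv
  rw [abs_zero]
  exact hForm_zero_inj huv

theorem abs_le_half_of_h_zero {u : ℝ} (hu : u ∈ Icc (-1 : ℝ) 1) (h0 : P.h α 0 u = 0) :
    |u| ≤ 1 / 2 := by
  rw [P.h_eq_hForm α (by simp) hu, abs_zero] at h0
  exact hForm_zero_eq_zero h0

end ReesData

/-! ### Coordinates on the circle -/

namespace ReesData

theorem coe_coord (x : UnitAddCircle) : ((coord x : ℝ) : UnitAddCircle) = x :=
  AddCircle.coe_equivIco

theorem coord_mem (x : UnitAddCircle) : coord x ∈ Ico (-1 / 2 : ℝ) (1 / 2) := by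
  have := (AddCircle.equivIco (1 : ℝ) (-1 / 2) x).2
  have e : (-1 / 2 + 1 : ℝ) = 1 / 2 := by norm_num
  exact ⟨this.1, this.2.trans_eq e⟩

theorem coord_coe {r : ℝ} (hr : r ∈ Ico (-1 / 2 : ℝ) (1 / 2)) : coord (r : UnitAddCircle) = r := by
  refine AddCircle.equivIco_coe_of_mem ?_
  rwa [show (-1 / 2 + 1 : ℝ) = 1 / 2 by norm_num]

theorem coord_coe_of_abs_lt {r : ℝ} (hr : |r| < 1 / 2) : coord (r : UnitAddCircle) = r := by
  obtain ⟨h1, h2⟩ := abs_lt.1 hr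
  exact coord_coe ⟨by linarith, h2⟩

theorem norm_coe_circle {r : ℝ} (hr : |r| ≤ 1 / 2) : ‖(r : UnitAddCircle)‖ = |r| :=
  (AddCircle.norm_coe_eq_abs_iff 1 one_ne_zero).2 (by simpa using hr)

theorem abs_coord_le (x : UnitAddCircle) : |coord x| ≤ 1 / 2 := by
  have := coord_mem x
  rw [abs_le]
  exact ⟨by linarith [this.1], this.2.le⟩

theorem norm_eq_abs_coord (x : UnitAddCircle) : ‖x‖ = |coord x| := by
  conv_lhs => rw [← coe_coord x]
  exact norm_coe_circle (abs_coord_le x)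

theorem coord_zero : coord 0 = 0 := by
  have := coord_coe_of_abs_lt (r := 0) (by norm_num)
  simpa using this

theorem coord_eq_zero {x : UnitAddCircle} : coord x = 0 ↔ x = 0 := by
  rw [← norm_eq_zero (a := x), norm_eq_abs_coord, abs_eq_zero]

theorem coord_injective : Function.Injective coord := fun x y h => by
  rw [← coe_coord x, h, coe_coord]

theorem continuousAt_coord {x : UnitAddCircle} (hx : ‖x‖ < 1 / 2) : ContinuousAt coord x := by
  refine continuous_subtype_val.continuousAt.comp (AddCircle.continuousAt_equivIco 1 (-1 / 2) ?_)
  rintro rfl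
  rw [norm_coe_circle (by norm_num [abs_div])] at hx
  norm_num [abs_div] at hx

theorem abs_coord_sub_coord {x y : UnitAddCircle} (hx : ‖x‖ ≤ 1 / 4) (hy : ‖y‖ ≤ 1 / 4) :
    |coord x - coord y| = dist x y := by
  rw [norm_eq_abs_coord] at hx hy
  rw [dist_eq_norm]
  conv_rhs => rw [← coe_coord x, ← coe_coord y, ← AddCircle.coe_sub]
  refine (norm_coe_circle ?_).symm
  calc |coord x - coord y| ≤ |coord x| + |coord y| := abs_sub _ _
    _ ≤ 1 / 2 := by linarith

variable (P : ReesData) (α : ℕ → unitInterval) (δ : ℕ → ℝ)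

theorem mem_square {n : ℕ} {p : Torus} : p ∈ P.square δ n ↔ dist p (P.z n) ≤ δ n := by
  rw [Prod.dist_eq, max_le_iff, dist_eq_norm, dist_eq_norm]
  constructor
  · rintro ⟨t, s, ht, hs, rfl⟩
    simp only [add_sub_cancel_left]
    have : ∀ r : ℝ, ‖(r : UnitAddCircle)‖ ≤ |r| := fun r => by
      simpa using QuotientAddGroup.norm_mk_le_norm (S := AddSubgroup.zmultiples (1 : ℝ)) (m := r)
    exact ⟨(this t).trans ht, (this s).trans hs⟩
  · rintro ⟨h1, h2⟩
    refine ⟨coord (p.1 - (P.z n).1), coord (p.2 - (P.z n).2), ?_, ?_, ?_⟩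
    · rwa [← norm_eq_abs_coord]
    · rwa [← norm_eq_abs_coord]
    · simp [coe_coord]

/-! ### The inverse of `h` -/

theorem h_abs (t : ℝ) : P.h α |t| = P.h α t := by
  simp [h]

variable {c : ℝ}

theorem continuousOn_h_right {t : ℝ} (ht : |t| ≤ 1) : ContinuousOn (P.h α t) (Icc (-1) 1) :=
  (P.continuousOn_h α).comp (f := fun u : ℝ => (t, u)) (by fun_prop) fun _ hu => ⟨abs_le.1 ht, hu⟩

theorem surjOn_h {t : ℝ} (ht : |t| ≤ 1) : SurjOn (P.h α t) (Icc (-1) 1) (Icc (-1) 1) := by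
  have h1 := P.h_outer α ht le_rfl
  norm_num at h1
  have := intermediate_value_Icc (by norm_num : (-1 : ℝ) ≤ 1) (P.continuousOn_h_right α ht)
  rwa [h1.1, h1.2] at this

theorem hInv_mem {s : ℝ} (hc1 : |c| ≤ 1) (hs : s ∈ Icc (-1 : ℝ) 1) :
    P.hInv α c s ∈ Icc (-1 : ℝ) 1 :=
  Function.invFunOn_mem (P.surjOn_h α hc1 hs)

theorem h_hInv {s : ℝ} (hc1 : |c| ≤ 1) (hs : s ∈ Icc (-1 : ℝ) 1) : P.h α c (P.hInv α c s) = s :=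
  Function.invFunOn_eq (P.surjOn_h α hc1 hs)

theorem hInv_h {u : ℝ} (hc0 : c ≠ 0) (hc1 : |c| ≤ 1) (hu : u ∈ Icc (-1 : ℝ) 1) :
    P.hInv α c (P.h α c u) = u :=
  (P.injOn_h α hc1 hc0).leftInvOn_invFunOn hu

theorem continuousOn_hInv (hc0 : c ≠ 0) (hc1 : |c| ≤ 1) : ContinuousOn (P.hInv α c) (Icc (-1) 1) := by
  have hc : 0 < |c| := abs_pos.2 hc0
  refine (LipschitzOnWith.of_dist_le_mul (K := (3 / |c|).toNNReal) ?_).continuousOn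
  intro s hs s' hs'
  have := P.h_increment α hc1 (P.hInv_mem α hc1 hs) (P.hInv_mem α hc1 hs')
  rw [P.h_hInv α hc1 hs, P.h_hInv α hc1 hs'] at this
  rw [Real.dist_eq, Real.dist_eq, Real.coe_toNNReal _ (by positivity), div_mul_eq_mul_div, le_div_iff₀ hc]
  linarith

section fibre

variable (hc0 : 0 < c) (hc1 : c ≤ 1)
include hc0 hc1

theorem hInv_self : P.hInv α c c = (1 + c) / 2 ∧ P.hInv α c (-c) = -((1 + c) / 2) := by
  have hc : |c| = c := abs_of_pos hc0
  have := P.h_outer α hc.le hc1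
  have e1 := P.hInv_h α hc0.ne' (by rwa [hc]) (u := (1 + c) / 2) ⟨by linarith, by linarith⟩
  have e2 := P.hInv_h α hc0.ne' (by rwa [hc]) (u := -((1 + c) / 2)) ⟨by linarith, by linarith⟩
  rw [this.1] at e1
  rw [this.2] at e2
  exact ⟨e1, e2⟩

theorem abs_hInv_le {s : ℝ} (hs : |s| ≤ c) : |P.hInv α c s| ≤ (1 + c) / 2 := by
  have hc : |c| = c := abs_of_pos hc0
  have hs1 := abs_le.1 hs
  have o := P.h_outer α hc.le hc1
  have hs' : s ∈ Icc (-1 : ℝ) 1 := ⟨by linarith, by linarith⟩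
  have m := P.hInv_mem α (hc.le.trans hc1) hs'
  have e := P.h_hInv α (hc.le.trans hc1) hs'
  have st : StrictMonoOn (P.h α c) (Icc (-1) 1) :=
    (P.monotoneOn_h α (hc.le.trans hc1)).strictMonoOn_of_injOn (P.injOn_h α (hc.le.trans hc1) hc0.ne')
  rw [abs_le]
  constructor
  · rw [← st.le_iff_le ⟨by linarith, by linarith⟩ m, o.2, e]
    exact hs1.1
  · rw [← st.le_iff_le m ⟨by linarith, by linarith⟩, o.1, e]
    exact hs1.2

theorem abs_h_hInv_le {t s : ℝ} (ht : |t| ≤ c) (hs : |s| ≤ c) : |P.h α t (P.hInv α c s)| ≤ c := by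
  have hi := abs_le.1 (P.abs_hInv_le α hc0 hc1 hs)
  have o := P.h_outer α ht hc1
  have m := P.monotoneOn_h α (ht.trans hc1)
  have mem : P.hInv α c s ∈ Icc (-1 : ℝ) 1 := ⟨by linarith, by linarith⟩
  rw [abs_le]
  constructor
  · conv_lhs => rw [← o.2]
    exact m ⟨by linarith, by linarith⟩ mem hi.1
  · conv_rhs => rw [← o.1]
    exact m mem ⟨by linarith, by linarith⟩ hi.2

/-- On the vertical sides `h_t` is `h_c` itself; on the horizontal ones `h_outer` applies. Hence
`Lam` glues continuously with the identity. -/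
theorem h_hInv_of_boundary {t s : ℝ} (ht : |t| ≤ c) (hs : |s| ≤ c) (hb : |t| = c ∨ |s| = c) :
    P.h α t (P.hInv α c s) = s := by
  have hs1 := abs_le.1 hs
  rcases hb with hb | hb
  · rw [← P.h_abs α t, hb]
    exact P.h_hInv α ((abs_of_pos hc0).le.trans hc1) ⟨by linarith, by linarith⟩
  · have hv := P.hInv_self α hc0 hc1
    have o := P.h_outer α ht hc1
    rcases (abs_eq hc0.le).1 hb with rfl | rfl
    · rw [hv.1, o.1]
    · rw [hv.2, o.2]

theorem continuousOn_h_hInv :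
    ContinuousOn (fun x : ℝ × ℝ => P.h α x.1 (P.hInv α c x.2)) (Icc (-c) c ×ˢ Icc (-c) c) := by
  have hc : |c| ≤ 1 := (abs_of_pos hc0).le.trans hc1
  have hi : ContinuousOn (fun x : ℝ × ℝ => P.hInv α c x.2) (Icc (-c) c ×ˢ Icc (-c) c) :=
    (P.continuousOn_hInv α hc0.ne' hc).comp continuousOn_snd
      fun x hx => ⟨by linarith [hx.2.1], by linarith [hx.2.2]⟩
  exact (P.continuousOn_h α).comp (f := fun x : ℝ × ℝ => (x.1, P.hInv α c x.2))
    (continuousOn_fst.prodMk hi) fun x hx => ⟨⟨by linarith [hx.1.1], by linarith [hx.1.2]⟩,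
      P.hInv_mem α hc ⟨by linarith [hx.2.1], by linarith [hx.2.2]⟩⟩

end fibre

/-! ### The maps `Lam` -/

variable {n : ℕ}

theorem mem_ball_iff {p : Torus} {r : ℝ} : dist p (P.z n) ≤ r ↔
    |coord (p.1 - (P.z n).1)| ≤ r ∧ |coord (p.2 - (P.z n).2)| ≤ r := by
  rw [Prod.dist_eq, max_le_iff, dist_eq_norm, dist_eq_norm, norm_eq_abs_coord, norm_eq_abs_coord]

theorem Lam_of_mem {p : Torus} (hp : dist p (P.z n) ≤ δ n) : P.Lam α δ n p =
    (p.1, (P.z n).2 + ((P.h α (coord (p.1 - (P.z n).1))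
      (P.hInv α (δ n) (coord (p.2 - (P.z n).2))) : ℝ) : UnitAddCircle)) :=
  if_pos (P.mem_ball_iff.1 hp)

theorem Lam_of_notMem {p : Torus} (hp : ¬ dist p (P.z n) ≤ δ n) : P.Lam α δ n p = p :=
  if_neg fun h => hp (P.mem_ball_iff.2 h)

@[simp]
theorem Lam_fst (p : Torus) : (P.Lam α δ n p).1 = p.1 := by
  by_cases hp : dist p (P.z n) ≤ δ n
  · rw [P.Lam_of_mem α δ hp]
  · rw [P.Lam_of_notMem α δ hp]

theorem Lam_of_column {p : Torus} (hp : δ n < dist p.1 (P.z n).1) : P.Lam α δ n p = p :=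
  P.Lam_of_notMem α δ fun h => absurd ((le_max_left _ _).trans h) (not_le.2 hp)

section

variable {δ} (h0 : 0 < δ n) (h1 : δ n < 1 / 2)
include h0 h1

theorem coord_Lam {p : Torus} (hp : dist p (P.z n) ≤ δ n) :
    coord ((P.Lam α δ n p).2 - (P.z n).2) =
      P.h α (coord (p.1 - (P.z n).1)) (P.hInv α (δ n) (coord (p.2 - (P.z n).2))) := by
  rw [P.Lam_of_mem α δ hp, add_sub_cancel_left]
  have := P.mem_ball_iff.1 hp
  exact coord_coe_of_abs_lt ((P.abs_h_hInv_le α h0 (by linarith) this.1 this.2).trans_lt h1)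

theorem dist_Lam_le {p : Torus} (hp : dist p (P.z n) ≤ δ n) : dist (P.Lam α δ n p) (P.z n) ≤ δ n := by
  have := P.mem_ball_iff.1 hp
  rw [P.mem_ball_iff, P.coord_Lam α h0 h1 hp, P.Lam_fst]
  exact ⟨this.1, P.abs_h_hInv_le α h0 (by linarith) this.1 this.2⟩

theorem dist_Lam_le_iff {p : Torus} {r : ℝ} (hr : δ n ≤ r) :
    dist (P.Lam α δ n p) (P.z n) ≤ r ↔ dist p (P.z n) ≤ r := by
  by_cases hp : dist p (P.z n) ≤ δ n
  · exact iff_of_true ((P.dist_Lam_le α h0 h1 hp).trans hr) (hp.trans hr)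
  · rw [P.Lam_of_notMem α δ hp]

theorem dist_Lam_self_le (p : Torus) : dist (P.Lam α δ n p) p ≤ 2 * δ n := by
  by_cases hp : dist p (P.z n) ≤ δ n
  · linarith [dist_triangle_right (P.Lam α δ n p) p (P.z n), P.dist_Lam_le α h0 h1 hp]
  · rw [P.Lam_of_notMem α δ hp, dist_self]
    linarith

/-- Off the central column `h_t` is injective; on it, `h_0` identifies only points that it sends to
`0`, that is, to `z n`. -/
theorem Lam_eq_Lam {p q : Torus} (hpq : P.Lam α δ n p = P.Lam α δ n q) :
    p = q ∨ P.Lam α δ n p = P.z n := by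
  have hm : dist p (P.z n) ≤ δ n ↔ dist q (P.z n) ≤ δ n := by
    rw [← P.dist_Lam_le_iff α h0 h1 le_rfl, hpq, P.dist_Lam_le_iff α h0 h1 le_rfl]
  by_cases hp : dist p (P.z n) ≤ δ n
  · have hq := hm.1 hp
    have hf : p.1 = q.1 := by rw [← P.Lam_fst α δ (n := n) p, hpq, P.Lam_fst]
    have hc := congrArg (fun w : Torus => coord (w.2 - (P.z n).2)) hpq
    simp only [P.coord_Lam α h0 h1 hp, P.coord_Lam α h0 h1 hq, hf] at hc
    have bp := P.mem_ball_iff.1 hp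
    have bq := P.mem_ball_iff.1 hq
    have habs : |δ n| ≤ 1 := by rw [abs_of_pos h0]; linarith
    have sp : coord (p.2 - (P.z n).2) ∈ Icc (-1 : ℝ) 1 := abs_le.1 (bp.2.trans (by linarith))
    have sq : coord (q.2 - (P.z n).2) ∈ Icc (-1 : ℝ) 1 := abs_le.1 (bq.2.trans (by linarith))
    have fin : P.hInv α (δ n) (coord (p.2 - (P.z n).2)) = P.hInv α (δ n) (coord (q.2 - (P.z n).2)) →
        p = q := by
      intro e
      have := congrArg (P.h α (δ n)) e
      rw [P.h_hInv α habs sp, P.h_hInv α habs sq] at this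
      exact Prod.ext hf (sub_left_injective (coord_injective this))
    by_cases ht : coord (q.1 - (P.z n).1) = 0
    · rw [ht] at hc
      rcases P.h_zero_inj α (P.hInv_mem α habs sp) (P.hInv_mem α habs sq) hc with e | e
      · exact Or.inl (fin e)
      · right
        rw [P.Lam_of_mem α δ hp, hf, ht, e]
        have := sub_eq_zero.1 (coord_eq_zero.1 ht)
        ext <;> simp [this]
    · exact Or.inl (fin (P.injOn_h α (bq.1.trans (by linarith)) ht (P.hInv_mem α habs sp)
        (P.hInv_mem α habs sq) hc))
  · rw [P.Lam_of_notMem α δ hp, P.Lam_of_notMem α δ (fun h => hp (hm.2 h))] at hpq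
    exact Or.inl hpq

theorem Lam_surjective : Function.Surjective (P.Lam α δ n) := by
  intro w
  by_cases hw : dist w (P.z n) ≤ δ n
  · obtain ⟨b1, b2⟩ := P.mem_ball_iff.1 hw
    set t := coord (w.1 - (P.z n).1)
    have hcont : ContinuousOn (fun s => P.h α t (P.hInv α (δ n) s)) (Icc (-(δ n)) (δ n)) :=
      (P.continuousOn_h_hInv α h0 (by linarith)).comp (f := fun s : ℝ => (t, s)) (by fun_prop)
        fun s hs => ⟨abs_le.1 b1, hs⟩
    have iv := intermediate_value_Icc (by linarith) hcont
    have e1 := P.h_hInv_of_boundary α h0 (by linarith) b1 (s := δ n) (abs_of_pos h0).le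
      (Or.inr (abs_of_pos h0))
    have e2 := P.h_hInv_of_boundary α h0 (by linarith) b1 (s := -(δ n))
      (by rw [abs_neg, abs_of_pos h0]) (Or.inr (by rw [abs_neg, abs_of_pos h0]))
    simp only [e1, e2] at iv
    obtain ⟨s, hs, hsw⟩ := iv (abs_le.1 b2)
    have hsa : |s| ≤ δ n := abs_le.2 hs
    have hcs : coord ((P.z n).2 + (s : UnitAddCircle) - (P.z n).2) = s := by
      rw [add_sub_cancel_left]
      exact coord_coe_of_abs_lt (hsa.trans_lt h1)
    refine ⟨(w.1, (P.z n).2 + (s : UnitAddCircle)), ?_⟩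
    have hb : dist ((w.1, (P.z n).2 + (s : UnitAddCircle)) : Torus) (P.z n) ≤ δ n :=
      P.mem_ball_iff.2 ⟨b1, by rwa [hcs]⟩
    have hsw : P.h α t (P.hInv α (δ n) s) = coord (w.2 - (P.z n).2) := hsw
    rw [P.Lam_of_mem α δ hb, hcs, hsw, coe_coord, add_sub_cancel]
  · exact ⟨w, P.Lam_of_notMem α δ hw⟩

theorem continuous_Lam : Continuous (P.Lam α δ n) := by
  have e : P.Lam α δ n = fun p => if dist p (P.z n) ≤ δ n then
      (p.1, (P.z n).2 + ((P.h α (coord (p.1 - (P.z n).1))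
      (P.hInv α (δ n) (coord (p.2 - (P.z n).2))) : ℝ) : UnitAddCircle)) else p := by
    ext1 p
    split_ifs with hp
    · exact P.Lam_of_mem α δ hp
    · exact P.Lam_of_notMem α δ hp
  rw [e]
  refine continuous_if_le (by fun_prop) continuous_const ?_ continuousOn_id ?_
  · refine continuousOn_fst.prodMk (continuousOn_const.add ?_)
    refine (AddCircle.continuous_mk' 1).comp_continuousOn ?_
    refine (P.continuousOn_h_hInv α h0 (by linarith)).comp
      (f := fun p : Torus => (coord (p.1 - (P.z n).1), coord (p.2 - (P.z n).2))) ?_ ?_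
    · intro p hp
      rw [mem_ofPred_eq, Prod.dist_eq, max_le_iff, dist_eq_norm, dist_eq_norm] at hp
      refine ContinuousAt.continuousWithinAt (ContinuousAt.prodMk ?_ ?_)
      · exact ContinuousAt.comp (f := fun p : Torus => p.1 - (P.z n).1)
          (continuousAt_coord (hp.1.trans_lt h1)) (by fun_prop)
      · exact ContinuousAt.comp (f := fun p : Torus => p.2 - (P.z n).2)
          (continuousAt_coord (hp.2.trans_lt h1)) (by fun_prop)
    · intro p hp
      have := P.mem_ball_iff.1 hp
      exact ⟨abs_le.1 this.1, abs_le.1 this.2⟩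
  · intro p hp
    have hb := P.mem_ball_iff.1 hp.le
    have hbd : |coord (p.1 - (P.z n).1)| = δ n ∨ |coord (p.2 - (P.z n).2)| = δ n := by
      rw [← norm_eq_abs_coord, ← norm_eq_abs_coord, ← dist_eq_norm, ← dist_eq_norm]
      rw [Prod.dist_eq] at hp
      rcases max_choice (dist p.1 (P.z n).1) (dist p.2 (P.z n).2) with e | e
      · exact Or.inl (e ▸ hp)
      · exact Or.inr (e ▸ hp)
    rw [P.h_hInv_of_boundary α h0 (by linarith) hb.1 hb.2 hbd, coe_coord, add_sub_cancel]

end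

/-- The maps `Lam` with disjoint squares commute. -/
theorem Lam_comm {m n : ℕ} (h0 : 0 < δ n) (h1 : δ n < 1 / 2) (h0' : 0 < δ m) (h1' : δ m < 1 / 2)
    (hd : Disjoint (P.square δ m) (P.square δ n)) (p : Torus) :
    P.Lam α δ m (P.Lam α δ n p) = P.Lam α δ n (P.Lam α δ m p) := by
  have key : ∀ q, dist q (P.z m) ≤ δ m → ¬ dist q (P.z n) ≤ δ n := fun q hm hn =>
    disjoint_left.1 hd ((P.mem_square δ).2 hm) ((P.mem_square δ).2 hn)
  by_cases hm : dist p (P.z m) ≤ δ m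
  · rw [P.Lam_of_notMem α δ (key _ hm), P.Lam_of_notMem α δ (key _ (P.dist_Lam_le α h0' h1' hm))]
  · rw [P.Lam_of_notMem α δ hm]
    by_cases hn : dist p (P.z n) ≤ δ n
    · exact P.Lam_of_notMem α δ fun h => key _ h (P.dist_Lam_le α h0 h1 hn)
    · rw [P.Lam_of_notMem α δ hn, P.Lam_of_notMem α δ hm]

end ReesData

namespace ReesData

variable (P : ReesData)

/-! ### The orbit of the base point -/

theorem T_apply (p : Torus) : P.T p = p + P.v := rfl

theorem T_zpow_apply (k : ℤ) (p : Torus) : (P.T ^ k) p = p + k • P.v := by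
  have hs : ∀ p : Torus, (P.T ^ (-1 : ℤ)) p = p - P.v := fun p => by
    rw [zpow_neg_one]
    change P.T.symm p = _
    rw [Homeomorph.symm_apply_eq, T_apply, sub_add_cancel]
  induction k using Int.induction_on generalizing p with
  | zero => simp
  | succ k ih =>
    rw [zpow_add, zpow_one, Homeomorph.mul_apply, ih, T_apply, add_smul, one_smul]
    abel
  | pred k ih =>
    rw [sub_smul, one_smul, sub_eq_add_neg, zpow_add, Homeomorph.mul_apply, ih, hs]
    abel

theorem z_eq (n : ℕ) : P.z n = P.z₀ + (Equiv.intEquivNat.symm n) • P.v := P.T_zpow_apply _ _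

theorem T_z (n : ℕ) : P.T (P.z n) = P.z (σ n) := by
  rw [z_eq, z_eq, T_apply, σ, Equiv.symm_apply_apply, add_smul, one_smul, add_assoc]

theorem T_symm_apply (p : Torus) : P.T.symm p = p - P.v := by
  rw [Homeomorph.symm_apply_eq, T_apply, sub_add_cancel]

theorem T_symm_z (n : ℕ) : P.T.symm (P.z n) = P.z (τ n) := by
  rw [z_eq, z_eq, T_symm_apply, τ, Equiv.symm_apply_apply, sub_smul, one_smul, add_sub_assoc]

theorem σ_τ (n : ℕ) : σ (τ n) = n := by simp [σ, τ]

theorem τ_σ (n : ℕ) : τ (σ n) = n := by simp [σ, τ]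

theorem σ_near (n : ℕ) : σ n ≤ n + 2 ∧ n ≤ σ n + 2 := by
  obtain ⟨i, rfl⟩ := Equiv.intEquivNat.surjective n
  rw [σ, Equiv.symm_apply_apply]
  rcases i with k | k
  · have a : Equiv.intEquivNat (Int.ofNat k) = 2 * k := rfl
    have b : Equiv.intEquivNat (Int.ofNat k + 1) = 2 * (k + 1) := rfl
    rw [a, b]
    omega
  · rcases k with _ | k
    · have a : Equiv.intEquivNat (Int.negSucc 0) = 2 * 0 + 1 := rfl
      have b : Equiv.intEquivNat (Int.negSucc 0 + 1) = 2 * 0 := rfl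
      rw [a, b]
      omega
    · have a : Equiv.intEquivNat (Int.negSucc (k + 1)) = 2 * (k + 1) + 1 := rfl
      have b : Equiv.intEquivNat (Int.negSucc (k + 1) + 1) = 2 * k + 1 := rfl
      rw [a, b]
      omega

theorem τ_near (n : ℕ) : τ n ≤ n + 2 ∧ n ≤ τ n + 2 := by
  have := σ_near (τ n)
  rw [σ_τ] at this
  exact this.symm

/-- The first coordinate of the rotation vector has infinite order. -/
theorem zsmul_v_fst_ne {k : ℤ} (hk : k ≠ 0) : k • P.v.1 ≠ 0 := by
  intro h
  have hd := P.rotation_minimal 0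
  have hd1 : Dense (Prod.fst '' range fun n : ℤ => (torusRotation P.v ^ n) 0) :=
    Prod.fst_surjective.denseRange.dense_image continuous_fst hd
  -- If `k` annihilates the first coordinate of `v`, the first coordinates along an orbit depend
  -- only on residues modulo `|k|`; a finite set would then be dense in the circle.
  have hfin : (Prod.fst '' range fun n : ℤ => (torusRotation P.v ^ n) (0 : Torus)).Finite := by
    refine ((Set.finite_Ico 0 |k|).image fun n : ℤ => n • P.v.1).subset ?_
    rintro _ ⟨_, ⟨n, rfl⟩, rfl⟩
    refine ⟨n % |k|, ⟨Int.emod_nonneg _ (abs_ne_zero.2 hk), Int.emod_lt_of_pos _ (abs_pos.2 hk)⟩, ?_⟩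
    have e := P.T_zpow_apply n 0
    change (torusRotation P.v ^ n) 0 = _ at e
    have hk' : |k| • P.v.1 = 0 := by
      rcases abs_choice k with e | e <;> rw [e]
      · exact h
      · rw [neg_smul, h, neg_zero]
    simp only [e, zero_add, Prod.smul_fst]
    conv_rhs => rw [← Int.emod_add_mul_ediv n |k|, add_smul, mul_comm, mul_smul, hk', smul_zero,
      add_zero]
  have huniv : (univ : Set UnitAddCircle).Finite := by
    rw [← hd1.closure_eq, hfin.isClosed.closure_eq]
    exact hfin
  have hinj : InjOn (fun r : ℝ => (r : UnitAddCircle)) (Ico (-1 / 2) (1 / 2)) := fun r hr s hs hrs => by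
    rw [← coord_coe hr, ← coord_coe hs]
    exact congrArg coord hrs
  exact (Ico_infinite (by norm_num : (-1 / 2 : ℝ) < 1 / 2)).image hinj (huniv.subset (subset_univ _))

theorem x_injective : Function.Injective fun n => (P.z n).1 := by
  intro m n hmn
  by_contra hne
  refine P.zsmul_v_fst_ne (k := Equiv.intEquivNat.symm m - Equiv.intEquivNat.symm n) ?_ ?_
  · exact sub_ne_zero.2 fun h => hne (Equiv.intEquivNat.symm.injective h)
  · simp only [z_eq, Prod.fst_add, Prod.smul_fst, add_right_inj] at hmn
    rw [sub_smul, hmn, sub_self]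

theorem dense_X : Dense P.X := by
  have hpre : (((↑) : ℝ → UnitAddCircle) ⁻¹' (range fun n => (P.z n).1)).Countable := by
    have : ((↑) : ℝ → UnitAddCircle) ⁻¹' (range fun n => (P.z n).1) ⊆
        range fun x : ℕ × ℤ => coord (P.z x.1).1 + x.2 := by
      rintro r ⟨n, hn⟩
      have : ((coord (P.z n).1 : ℝ) : UnitAddCircle) = r := by rw [coe_coord]; exact hn
      obtain ⟨k, hk⟩ := (QuotientAddGroup.eq_iff_sub_mem.1 this.symm)
      refine ⟨(n, k), ?_⟩
      simp at hk ⊢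
      linarith
    exact (countable_range _).mono this
  have hd : Dense (range fun n => (P.z n).1)ᶜ := by
    have := (hpre.dense_compl ℝ)
    have hs : Function.Surjective ((↑) : ℝ → UnitAddCircle) := fun x => ⟨coord x, coe_coord x⟩
    have := hs.denseRange.dense_image (AddCircle.continuous_mk' 1) this
    rwa [← preimage_compl, image_preimage_eq _ hs] at this
  have := hd.prod (dense_univ (X := UnitAddCircle))
  refine this.mono ?_
  rintro p ⟨hp, -⟩ n hn
  exact hp ⟨n, hn.symm⟩

theorem T_mem_X {p : Torus} (hp : p ∈ P.X) : P.T p ∈ P.X := by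
  intro n hn
  apply hp (τ n)
  rw [← T_symm_z, T_symm_apply, Prod.fst_sub, ← hn, T_apply, Prod.fst_add, add_sub_cancel_right]

/-! ### Ordered compositions -/

variable (α : ℕ → unitInterval) (δ : ℕ → ℝ)

/-- The bounds under which the maps `Lam` are continuous. -/
structure Short : Prop where
  pos : ∀ n, 0 < δ n
  lt_half : ∀ n, δ n < 1 / 2

/-- The conditions on the squares that do not refer to the maps `Lam`. -/
structure Tame : Prop extends Short δ where
  disjoint_near : ∀ m n : ℕ, m ≠ n → m ≤ n + 5 → n ≤ m + 5 →
    Disjoint (P.square δ m) (P.square δ n)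
  lt_dist : ∀ n, ∀ m < n, δ n < dist (P.z m).1 (P.z n).1 / n

variable {P α δ} in
theorem Admissible.tame (hA : P.Admissible α δ) : P.Tame δ where
  pos := hA.pos
  disjoint_near := hA.disjoint_near
  lt_dist := hA.lt_dist
  lt_half n := by
    -- A square of half-side at least `1/2` is the whole torus and meets the next one.
    by_contra! hn
    refine disjoint_left.1 (hA.disjoint_near n (n + 1) (by omega) (by omega) (by omega))
      (show P.z (n + 1) ∈ _ from (P.mem_square δ).2 ?_) ((P.mem_square δ).2 ?_)
    · exact P.mem_ball_iff.2 ⟨(abs_coord_le _).trans hn, (abs_coord_le _).trans hn⟩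
    · rw [dist_self]
      exact (hA.pos _).le

variable {P δ} in
theorem Tame.lt_dist' (h : P.Tame δ) {m n : ℕ} (hmn : m < n) :
    δ n < dist (P.z n).1 (P.z m).1 := by
  rw [dist_comm]
  refine (h.lt_dist n m hmn).trans_le (div_le_self dist_nonneg ?_)
  exact_mod_cast Nat.one_le_of_lt hmn

open Classical in
/-- The composition of the `Lam i` with `i < n` and `i ∈ K`, in increasing order. -/
noncomputable def stack (K : Set ℕ) : ℕ → Torus → Torus
  | 0 => id
  | n + 1 => if n ∈ K then P.Lam α δ n ∘ stack K n else stack K n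

variable {K K' : Set ℕ} {n : ℕ}

theorem stack_succ_of_mem (h : n ∈ K) (p : Torus) :
    P.stack α δ K (n + 1) p = P.Lam α δ n (P.stack α δ K n p) := by
  rw [stack, if_pos h]
  rfl

theorem stack_succ_of_notMem (h : n ∉ K) (p : Torus) :
    P.stack α δ K (n + 1) p = P.stack α δ K n p := by
  rw [stack, if_neg h]

theorem stack_congr {δ' : ℕ → ℝ} (hδ : ∀ i < n, δ i = δ' i) (hK : ∀ i < n, i ∈ K ↔ i ∈ K')
    (p : Torus) : P.stack α δ K n p = P.stack α δ' K' n p := by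
  induction n with
  | zero => rfl
  | succ n ih =>
    have ih := ih (fun i hi => hδ i (by omega)) (fun i hi => hK i (by omega))
    by_cases h : n ∈ K
    · rw [stack_succ_of_mem _ _ _ h, stack_succ_of_mem _ _ _ ((hK n (by omega)).1 h), ih]
      simp only [Lam, hδ n (by omega)]
    · rw [stack_succ_of_notMem _ _ _ h,
        stack_succ_of_notMem _ _ _ (fun h' => h ((hK n (by omega)).2 h')), ih]

@[simp]
theorem stack_fst (p : Torus) : (P.stack α δ K n p).1 = p.1 := by
  induction n with
  | zero => rfl
  | succ n ih =>
    by_cases h : n ∈ K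
    · rw [stack_succ_of_mem _ _ _ h, Lam_fst, ih]
    · rw [stack_succ_of_notMem _ _ _ h, ih]

variable {P δ}

theorem Short.continuous_stack (h : Short δ) : Continuous (P.stack α δ K n) := by
  induction n with
  | zero => exact continuous_id
  | succ n ih =>
    rw [stack]
    split_ifs
    · exact (P.continuous_Lam α (h.pos n) (h.lt_half n)).comp ih
    · exact ih

theorem Short.stack_surjective (h : Short δ) : Function.Surjective (P.stack α δ K n) := by
  induction n with
  | zero => exact Function.surjective_id
  | succ n ih =>
    rw [stack]
    split_ifs
    · exact (P.Lam_surjective α (h.pos n) (h.lt_half n)).comp ih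
    · exact ih

theorem Short.stack_injective (h : Short δ) {p q : Torus}
    (hp : ∀ k ∈ K, k < n → p.1 ≠ (P.z k).1) (hpq : P.stack α δ K n p = P.stack α δ K n q) : p = q := by
  induction n with
  | zero => exact hpq
  | succ n ih =>
    refine ih (fun k hk hkn => hp k hk (by omega)) ?_
    by_cases hn : n ∈ K
    · rw [stack_succ_of_mem _ _ _ hn, stack_succ_of_mem _ _ _ hn] at hpq
      refine (P.Lam_eq_Lam α (h.pos n) (h.lt_half n) hpq).resolve_right fun e => hp n hn (by omega) ?_
      rw [← e, Lam_fst, stack_fst]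
    · rwa [stack_succ_of_notMem _ _ _ hn, stack_succ_of_notMem _ _ _ hn] at hpq

theorem Short.bijOn_stack (h : Short δ) : BijOn (P.stack α δ K n) P.X P.X := by
  refine ⟨fun p hp k => ?_, fun p hp q hq => h.stack_injective α fun k _ _ => hp k, fun w hw => ?_⟩
  · rw [stack_fst]
    exact hp k
  · obtain ⟨p, rfl⟩ := h.stack_surjective (P := P) α (K := K) (n := n) w
    refine ⟨p, fun k => ?_, rfl⟩
    rw [← P.stack_fst α δ (K := K) (n := n) p]
    exact hw k

/-- The squares of index `> k` do not meet the column of `z k`. -/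
theorem Tame.stack_column (h : P.Tame δ) {k : ℕ} {p : Torus} (hp : p.1 = (P.z k).1) (hk : k < n) :
    P.stack α δ K n p = P.stack α δ K (k + 1) p := by
  induction n, hk using Nat.le_induction with
  | base => rfl
  | succ n hn ih =>
    by_cases hnK : n ∈ K
    · rw [stack_succ_of_mem _ _ _ hnK, P.Lam_of_column, ih]
      rw [stack_fst, hp, dist_comm]
      exact h.lt_dist' hn
    · rw [stack_succ_of_notMem _ _ _ hnK, ih]

theorem Short.dist_stack_succ_le (h : Short δ) (p : Torus) :
    dist (P.stack α δ K (n + 1) p) (P.stack α δ K n p) ≤ 2 * δ n := by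
  by_cases hn : n ∈ K
  · rw [stack_succ_of_mem _ _ _ hn]
    exact P.dist_Lam_self_le α (h.pos n) (h.lt_half n) _
  · rw [stack_succ_of_notMem _ _ _ hn, dist_self]
    linarith [h.pos n]

/-! ### Reordering -/

theorem stack_empty (p : Torus) : P.stack α δ ∅ n p = p := by
  induction n with
  | zero => rfl
  | succ n ih => rw [stack_succ_of_notMem _ _ _ (notMem_empty n), ih]

/-- `Lam j` slides down past the maps of larger index in `K`, since these are at most 5 indices away
and so have squares disjoint from that of `j`. -/
theorem Tame.Lam_stack (h : P.Tame δ) {j : ℕ} (hjn : j < n) (hj : j ∉ K)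
    (hK : ∀ i ∈ K, i ≤ j + 5) (p : Torus) :
    P.Lam α δ j (P.stack α δ K n p) = P.stack α δ (insert j K) n p := by
  induction n, hjn using Nat.le_induction with
  | base =>
    rw [stack_succ_of_notMem _ _ _ hj, stack_succ_of_mem _ _ _ (mem_insert j K)]
    congr 1
    exact P.stack_congr α δ (fun _ _ => rfl) (fun i hi => by simp [show i ≠ j by omega]) p
  | succ n hn ih =>
    by_cases hnK : n ∈ K
    · rw [stack_succ_of_mem _ _ _ hnK, stack_succ_of_mem _ _ _ (mem_insert_of_mem j hnK), ← ih]
      refine P.Lam_comm α δ (h.pos n) (h.lt_half n) (h.pos j) (h.lt_half j) ?_ _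
      exact h.disjoint_near j n (by omega) (by omega) (hK n hnK)
    · have : n ∉ insert j K := by
        simp [hnK, show n ≠ j by omega]
      rw [stack_succ_of_notMem _ _ _ hnK, stack_succ_of_notMem _ _ _ this, ih]

/-- As `π` displaces indices by at most 2, each new factor can be sorted into place, and the
composition depends only on the set of indices used. -/
theorem Tame.PhiPerm_eq_stack (h : P.Tame δ) {π : ℕ → ℕ} (hinj : Function.Injective π)
    (hnear : ∀ n, π n ≤ n + 2 ∧ n ≤ π n + 2) (m : ℕ) (hn : ∀ i ≤ m, π i < n) (p : Torus) :
    P.PhiPerm α δ π m p = P.stack α δ (π '' Iic m) n p := by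
  induction m with
  | zero =>
    have e : π '' Iic 0 = insert (π 0) ∅ := by
      ext i
      simp [eq_comm]
    rw [e, ← h.Lam_stack α (hn 0 le_rfl) (notMem_empty _) (by simp), stack_empty]
    rfl
  | succ m ih =>
    have e : π '' Iic (m + 1) = insert (π (m + 1)) (π '' Iic m) := by
      rw [← image_insert_eq]
      congr 1
      ext i
      simp only [mem_Iic, mem_insert_iff]
      omega
    rw [e, ← h.Lam_stack α (hn _ le_rfl), PhiPerm, Function.comp_apply, ih fun i hi => hn i (by omega)]
    · rintro ⟨i, hi, e⟩
      have := hinj e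
      simp only [mem_Iic] at hi
      omega
    · rintro _ ⟨i, hi, rfl⟩
      simp only [mem_Iic] at hi
      have := hnear i
      have := hnear (m + 1)
      omega

theorem Tame.PhiSeq_eq_stack (_ : P.Tame δ) (n : ℕ) (p : Torus) :
    P.PhiSeq α δ n p = P.stack α δ univ (n + 1) p := by
  rw [PhiSeq]
  induction n with
  | zero => rw [stack_succ_of_mem _ _ _ (mem_univ _)]; rfl
  | succ n ih =>
    rw [stack_succ_of_mem _ _ _ (mem_univ _), ← ih]
    rfl

end ReesData

/-! ### Collapsing maps and the extension of lifts -/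

namespace ReesData

variable (P : ReesData) (α β : ℕ → unitInterval)

/-- `Ψ` is a continuous fibrewise map that is injective except over the points `z k`, `k ∈ K`; near
the fibre over `z k` it is described by the functions `h^α_t`, up to an error `o(t)`. -/
structure Collapse (Ψ : Torus → Torus) (K : Set ℕ) : Prop where
  cont : Continuous Ψ
  fst : ∀ p, (Ψ p).1 = p.1
  inj : ∀ p q, Ψ p = Ψ q → p = q ∨ ∃ k ∈ K, Ψ p = P.z k
  chart : ∀ k ∈ K, ∃ U : Torus → ℝ, (∀ p, U p ∈ Icc (-1 : ℝ) 1) ∧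
    (∀ p, Ψ p = P.z k → ContinuousAt U p) ∧
    (∀ p q, Ψ p = P.z k → Ψ q = P.z k → U p = U q → p = q) ∧
    ∀ p₀, Ψ p₀ = P.z k → ∀ η > 0, ∀ᶠ p in 𝓝 p₀,
      |coord ((Ψ p).2 - (P.z k).2) - P.h α (coord (p.1 - (P.z k).1)) (U p)| ≤
        η * |coord (p.1 - (P.z k).1)|

variable {P α β}

section comparison

variable {Ψ₁ Ψ₂ H : Torus → Torus} {K₁ K₂ : Set ℕ} {w : Torus} {π : ℕ → ℕ}
  (h₁ : P.Collapse α Ψ₁ K₁) (h₂ : P.Collapse β Ψ₂ K₂) (hαβ : C0Rel α β)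
  (hπ : ∀ k, P.z k + w = P.z (π k)) (hK : ∀ k ∈ K₂, ∃ j ∈ K₁, π j = k)
  (hH : ∀ p ∈ P.X, Ψ₂ (H p) = Ψ₁ p + w)
include h₁ h₂ hH

theorem Collapse.limit_apply {p₀ r : Torus} {G : Ultrafilter Torus} (hG : ↑G ≤ 𝓝[P.X] p₀)
    (hr : Tendsto H G (𝓝 r)) : Ψ₂ r = Ψ₁ p₀ + w := by
  have e1 : Tendsto (fun p => Ψ₂ (H p)) G (𝓝 (Ψ₂ r)) := (h₂.cont.tendsto r).comp hr
  have e2 : Tendsto (fun p => Ψ₁ p + w) G (𝓝 (Ψ₁ p₀ + w)) :=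
    ((h₁.cont.add continuous_const).tendsto p₀).mono_left (hG.trans nhdsWithin_le_nhds)
  have hX : ∀ᶠ p in (G : Filter Torus), p ∈ P.X := hG self_mem_nhdsWithin
  exact tendsto_nhds_unique (e1.congr' (hX.mono fun p hp => hH p hp)) e2

include hαβ in
-- Along `G` the same displacement from the central point is `h^α_t (U₁ p)` and `h^β_t (U₂ (H p))`,
-- both up to `o(t)`. Replacing `h^α_t` by `h^β_t` costs another `o(t)`, and expansion by `t/3`
-- forces `U₂ (H p) - U₁ p → 0`.
theorem Collapse.chart_limit {p₀ r : Torus} {G : Ultrafilter Torus} (hG : ↑G ≤ 𝓝[P.X] p₀)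
    (hr : Tendsto H G (𝓝 r)) {j k : ℕ} (hjk : P.z j + w = P.z k) (hj : Ψ₁ p₀ = P.z j)
    {U₁ U₂ : Torus → ℝ} (m₁ : ∀ p, U₁ p ∈ Icc (-1 : ℝ) 1) (m₂ : ∀ p, U₂ p ∈ Icc (-1 : ℝ) 1)
    (c₁ : ContinuousAt U₁ p₀) (c₂ : ContinuousAt U₂ r)
    (a₁ : ∀ η > 0, ∀ᶠ p in 𝓝 p₀,
      |coord ((Ψ₁ p).2 - (P.z j).2) - P.h α (coord (p.1 - (P.z j).1)) (U₁ p)| ≤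
        η * |coord (p.1 - (P.z j).1)|)
    (a₂ : ∀ η > 0, ∀ᶠ p in 𝓝 r,
      |coord ((Ψ₂ p).2 - (P.z k).2) - P.h β (coord (p.1 - (P.z k).1)) (U₂ p)| ≤
        η * |coord (p.1 - (P.z k).1)|) : U₂ r = U₁ p₀ := by
  have hX : ∀ᶠ p in (G : Filter Torus), p ∈ P.X := hG self_mem_nhdsWithin
  have hG' : (G : Filter Torus) ≤ 𝓝 p₀ := hG.trans nhdsWithin_le_nhds
  have lim : Tendsto (fun p => |U₂ (H p) - U₁ p|) G (𝓝 |U₂ r - U₁ p₀|) :=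
    ((c₂.tendsto.comp hr).sub (c₁.tendsto.mono_left hG')).abs
  have hp₀ : p₀.1 = (P.z j).1 := by rw [← hj, h₁.fst]
  have ht : Tendsto (fun p : Torus => |coord (p.1 - (P.z j).1)|) G (𝓝[>] 0) := by
    refine tendsto_nhdsWithin_iff.2 ⟨?_, hX.mono fun p hp => ?_⟩
    · have : Tendsto (fun p : Torus => ‖p.1 - (P.z j).1‖) (𝓝 p₀) (𝓝 ‖p₀.1 - (P.z j).1‖) :=
        Continuous.tendsto (by fun_prop) p₀
      rw [hp₀, sub_self, norm_zero] at this
      simpa only [norm_eq_abs_coord] using this.mono_left hG'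
    · exact abs_pos.2 fun h => hp j (sub_eq_zero.1 (coord_eq_zero.1 h))
  have hp := (P.tendsto_pFun_sub α β hαβ).comp ht
  -- The two chart errors and the change of parameter give `1 + 1 + 12 = 14`; inverting the
  -- expansion `|t|/3` multiplies this by 3.
  have key : ∀ η > 0, |U₂ r - U₁ p₀| ≤ 42 * η := by
    intro η hη
    refine le_of_tendsto lim ?_
    filter_upwards [hX, hG' (a₁ η hη), hr (a₂ η hη), hp.eventually (gt_mem_nhds hη)] with p hpX b₁ b₂ b₃
    have f : (H p).1 - (P.z k).1 = p.1 - (P.z j).1 := by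
      rw [← h₂.fst, hH p hpX, ← hjk, Prod.fst_add, Prod.fst_add, h₁.fst]
      abel
    have s : (Ψ₂ (H p)).2 - (P.z k).2 = (Ψ₁ p).2 - (P.z j).2 := by
      rw [hH p hpX, ← hjk, Prod.snd_add, Prod.snd_add]
      abel
    have b₂ : |coord ((Ψ₂ (H p)).2 - (P.z k).2) -
      P.h β (coord ((H p).1 - (P.z k).1)) (U₂ (H p))| ≤ η * |coord ((H p).1 - (P.z k).1)| := b₂
    rw [f, s] at b₂
    have t0 : coord (p.1 - (P.z j).1) ≠ 0 := fun h => hpX j (sub_eq_zero.1 (coord_eq_zero.1 h))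
    have t1 : |coord (p.1 - (P.z j).1)| ≤ 1 := (abs_coord_le _).trans (by norm_num)
    simp only [Function.comp_apply] at b₃
    set t := coord (p.1 - (P.z j).1)
    have tp : 0 < |t| := abs_pos.2 t0
    have i₁ := P.abs_h_sub_le α β t1 t0 (m₁ p)
    have i₂ := P.h_increment β t1 (m₂ (H p)) (m₁ p)
    have i₃ : 12 * |t| * |P.pFun α (|t|) - P.pFun β (|t|)| ≤ 12 * |t| * η := by gcongr
    have i₄ : |P.h β t (U₂ (H p)) - P.h β t (U₁ p)| ≤ 14 * η * |t| := by
      rw [abs_le] at *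
      constructor <;> linarith [i₁.1, i₁.2, b₁.1, b₁.2, b₂.1, b₂.2]
    have i₅ : |t| * |U₂ (H p) - U₁ p| ≤ |t| * (42 * η) := by linarith
    exact le_of_mul_le_mul_left i₅ tp
  refine sub_eq_zero.1 (abs_nonpos_iff.1 (le_of_forall_pos_le_add fun η hη => ?_))
  linarith [key (η / 42) (by positivity)]

include hαβ hπ hK

/-- The map that conjugates two collapsing maps over `X` has limits everywhere. -/
theorem Collapse.exists_tendsto (p₀ : Torus) : ∃ r, Tendsto H (𝓝[P.X] p₀) (𝓝 r) := by
  have : (𝓝[P.X] p₀).NeBot := mem_closure_iff_nhdsWithin_neBot.1 (P.dense_X p₀)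
  obtain ⟨r, hr⟩ := exists_clusterPt_of_compactSpace (map H (𝓝[P.X] p₀))
  refine ⟨r, le_nhds_of_unique_clusterPt fun r' hr' => ?_⟩
  obtain ⟨G, hG, hGr⟩ := mapClusterPt_iff_ultrafilter.1 hr
  obtain ⟨G', hG', hGr'⟩ := mapClusterPt_iff_ultrafilter.1 hr'
  have e := h₁.limit_apply h₂ hH hG hGr
  have e' := h₁.limit_apply h₂ hH hG' hGr'
  -- Distinct cluster points lie over a common `z k`, and both have chart coordinate `U₁ p₀`, which
  -- determines the point.
  rcases h₂.inj r' r (e'.trans e.symm) with h | ⟨k, hk, hkr⟩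
  · exact h
  · obtain ⟨j, hj, rfl⟩ := hK k hk
    have hjp : Ψ₁ p₀ = P.z j := by
      have := e'.symm.trans (hkr.trans (hπ j).symm)
      exact add_right_cancel this
    obtain ⟨U₁, m₁, c₁, -, a₁⟩ := h₁.chart j hj
    obtain ⟨U₂, m₂, c₂, i₂, a₂⟩ := h₂.chart _ hk
    have hkr' : Ψ₂ r = P.z (π j) := by rw [e, ← e', hkr]
    refine i₂ _ _ hkr hkr' ?_
    rw [h₁.chart_limit h₂ hαβ hH hG hGr (hπ j) hjp m₁ m₂ (c₁ _ hjp) (c₂ _ hkr') (a₁ _ hjp)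
      (a₂ _ hkr'), h₁.chart_limit h₂ hαβ hH hG' hGr' (hπ j) hjp m₁ m₂ (c₁ _ hjp) (c₂ _ hkr)
      (a₁ _ hjp) (a₂ _ hkr)]

theorem Collapse.exists_extension : ∃ F : Torus → Torus, Continuous F ∧ EqOn F H P.X := by
  have lim := h₁.exists_tendsto h₂ hαβ hπ hK hH
  refine ⟨extendFrom P.X H, ?_, fun p hp => ?_⟩
  · rw [← continuousOn_univ]
    exact continuousOn_extendFrom (by rw [P.dense_X.closure_eq]) fun p _ => lim p
  · obtain ⟨r, hr⟩ := lim p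
    have hpr : H p = r := by
      have : Tendsto H (pure p) (𝓝 r) := hr.mono_left (pure_le_nhdsWithin hp)
      exact tendsto_nhds_unique (tendsto_pure_nhds H p) this
    refine extendFrom_eq (P.dense_X p) ?_
    rw [hpr]
    exact hr

theorem Collapse.uniformContinuousOn : UniformContinuousOn H P.X := by
  obtain ⟨F, hF, hFH⟩ := h₁.exists_extension h₂ hαβ hπ hK hH
  exact ((CompactSpace.uniformContinuous_of_continuous hF).uniformContinuousOn).congr hFH

end comparison

variable {δ : ℕ → ℝ} {K : Set ℕ}

/-- The maps `Lam j`, `j > k`, move the points of the columns near that of `z k` by an amount that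
is small compared with the distance of the columns. -/
theorem Tame.eventually_dist_stack_le (h : P.Tame δ) {k : ℕ} {p₀ : Torus} (hp₀ : p₀.1 = (P.z k).1)
    {η : ℝ} (hη : 0 < η) : ∀ᶠ p in 𝓝 p₀, ∀ N > k,
      dist (P.stack α δ K N p) (P.stack α δ K (k + 1) p) ≤ η * |coord (p.1 - (P.z k).1)| := by
  obtain ⟨J₀, hJ₀⟩ := exists_nat_ge (4 / η + 1)
  set J := max J₀ 3
  have hJ : 4 ≤ η * ((J : ℝ) - 1) := by
    have : (J₀ : ℝ) ≤ J := by exact_mod_cast le_max_left _ _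
    have : 4 / η ≤ (J : ℝ) - 1 := by linarith
    rw [div_le_iff₀ hη] at this
    linarith
  have hJ3 : 3 ≤ J := le_max_right _ _
  -- Close to `p₀` the columns avoid the first `J` squares after the `k`-th, so only squares of
  -- large index matter.
  have far : ∀ᶠ p : Torus in 𝓝 p₀, ∀ j ∈ Finset.range J, k < j → δ j < dist p.1 (P.z j).1 := by
    refine (Finset.eventually_all _).2 fun j _ => ?_
    by_cases hkj : k < j
    · have c : Continuous fun p : Torus => dist p.1 (P.z j).1 := by fun_prop
      have : δ j < dist p₀.1 (P.z j).1 := by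
        rw [hp₀, dist_comm]
        exact h.lt_dist' hkj
      exact ((c.tendsto p₀).eventually (lt_mem_nhds this)).mono fun p hp _ => hp
    · exact Eventually.of_forall fun p hp => absurd hp hkj
  filter_upwards [far] with p hp
  rw [← norm_eq_abs_coord, ← dist_eq_norm]
  set c := η * dist p.1 (P.z k).1
  have big : ∀ j > k, dist p.1 (P.z j).1 ≤ δ j → J ≤ j := fun j hj hd => by
    by_contra! hlt
    exact absurd (hp j (Finset.mem_range.2 hlt) hj) (not_lt.2 hd)
  have mul_lt : ∀ i j : ℕ, i < j → (j : ℝ) * δ j < dist (P.z i).1 (P.z j).1 := fun i j hij => by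
    have := h.lt_dist j i hij
    rwa [lt_div_iff₀ (by exact_mod_cast (Nat.zero_le i).trans_lt hij), mul_comm] at this
  -- From `j δ j < dist (x k) (x j)` and `dist p.1 (x j) ≤ δ j` one gets `(J - 1) δ j ≤ dist p.1 (x
  -- k)`; `J` was chosen with `η (J - 1) ≥ 4`.
  have start : ∀ j > k, dist p.1 (P.z j).1 ≤ δ j → 4 * δ j ≤ c := fun j hj hd => by
    have hJj : (J : ℝ) ≤ j := by exact_mod_cast big j hj hd
    have a := mul_lt k j hj
    have b := dist_triangle_left (P.z k).1 (P.z j).1 p.1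
    have d : ((J : ℝ) - 1) * δ j ≤ dist p.1 (P.z k).1 := by nlinarith [h.pos j]
    nlinarith [h.pos j, mul_le_mul_of_nonneg_left d hη.le]
  -- Squares met by one column shrink geometrically: `(j - 1) δ j < δ i`, and `J ≥ 3` makes the
  -- factor at least 2.
  have half : ∀ i > k, ∀ j > i, dist p.1 (P.z i).1 ≤ δ i → dist p.1 (P.z j).1 ≤ δ j →
      2 * δ j ≤ δ i := fun i hi j hj di dj => by
    have h3 : (3 : ℝ) ≤ j := by exact_mod_cast hJ3.trans (big j (by omega) dj)
    have a := mul_lt i j hj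
    have b := dist_triangle_left (P.z i).1 (P.z j).1 p.1
    nlinarith [h.pos j]
  -- The displacement so far is kept together with a reserve `4 δ j` for any square still to be met.
  -- A move uses `2 δ N`, and by `half` the next reserve is at most the remaining `2 δ N`.
  have main : ∀ N > k, dist (P.stack α δ K N p) (P.stack α δ K (k + 1) p) ≤ c ∧
      ∀ j ≥ N, dist p.1 (P.z j).1 ≤ δ j →
        dist (P.stack α δ K N p) (P.stack α δ K (k + 1) p) + 4 * δ j ≤ c := by
    intro N hN
    induction N, hN using Nat.le_induction with
    | base =>
      rw [Nat.succ_eq_add_one, dist_self]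
      refine ⟨mul_nonneg hη.le dist_nonneg, fun j hj hd => ?_⟩
      rw [zero_add]
      exact start j hj hd
    | succ N hN ih =>
      by_cases hd : dist p.1 (P.z N).1 ≤ δ N
      · have tri := dist_triangle (P.stack α δ K (N + 1) p) (P.stack α δ K N p)
          (P.stack α δ K (k + 1) p)
        have mv := h.dist_stack_succ_le (P := P) α (K := K) (n := N) p
        have i := ih.2 N le_rfl hd
        refine ⟨by linarith [h.pos N], fun j hj hdj => ?_⟩
        linarith [half N hN j hj hd hdj]
      · have e : P.stack α δ K (N + 1) p = P.stack α δ K N p := by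
          by_cases hNK : N ∈ K
          · rw [stack_succ_of_mem _ _ _ hNK, P.Lam_of_column]
            rw [stack_fst]
            exact not_le.1 hd
          · rw [stack_succ_of_notMem _ _ _ hNK]
        rw [e]
        exact ⟨ih.1, fun j hj => ih.2 j (by omega)⟩
  exact fun N hN => (main N hN).1

/-- The chart at `z k` is `U = (h_{δ k})⁻¹` of the vertical coordinate just before `Lam k` acts.
After `Lam k` the coordinate is exactly `h_t (U p)`, and the later maps change it by `o(t)`. -/
theorem Tame.collapse (h : P.Tame δ) {Ψ : Torus → Torus} (hc : Continuous Ψ)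
    (hlim : ∀ p, Tendsto (fun n => P.stack α δ K n p) atTop (𝓝 (Ψ p)))
    (hinj : ∀ p q : Torus, p.1 = q.1 → (∀ k ∈ K, p.1 ≠ (P.z k).1) → Ψ p = Ψ q → p = q) :
    P.Collapse α Ψ K := by
  have fst : ∀ p, (Ψ p).1 = p.1 := fun p => by
    refine tendsto_nhds_unique ((continuous_fst.tendsto _).comp (hlim p)) ?_
    simp only [Function.comp_def, stack_fst]
    exact tendsto_const_nhds
  have col : ∀ k ∈ K, ∀ p : Torus, p.1 = (P.z k).1 → Ψ p = P.Lam α δ k (P.stack α δ K k p) := by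
    intro k hk p hp
    rw [← stack_succ_of_mem _ _ _ hk]
    refine tendsto_nhds_unique (hlim p) (tendsto_const_nhds.congr' ?_)
    filter_upwards [eventually_gt_atTop k] with n hn using (h.stack_column α hp hn).symm
  have injk : ∀ k, ∀ p q : Torus, p.1 = (P.z k).1 → P.stack α δ K k p = P.stack α δ K k q → p = q :=
    fun k p q hp => h.stack_injective α fun i _ hik hi =>
      hik.ne (P.x_injective (hi.symm.trans hp))
  refine ⟨hc, fst, fun p q hpq => ?_, fun k hk => ?_⟩
  · have hf : p.1 = q.1 := by rw [← fst p, hpq, fst]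
    by_cases hk : ∃ k ∈ K, p.1 = (P.z k).1
    · obtain ⟨k, hk, hp⟩ := hk
      have hpq' := hpq
      rw [col k hk p hp, col k hk q (hf ▸ hp)] at hpq'
      rcases P.Lam_eq_Lam α (h.pos k) (h.lt_half k) hpq' with e | e
      · exact Or.inl (injk k p q hp e)
      · exact Or.inr ⟨k, hk, by rw [col k hk p hp, e]⟩
    · push Not at hk
      exact Or.inl (hinj p q hf hk hpq)
  · have h0 := h.pos k
    have h1 := h.lt_half k
    have habs : |δ k| ≤ 1 := by rw [abs_of_pos h0]; linarith
    have smem : ∀ x, coord x ∈ Icc (-1 : ℝ) 1 := fun x =>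
      abs_le.1 ((abs_coord_le x).trans (by norm_num))
    set s : Torus → ℝ := fun p => coord ((P.stack α δ K k p).2 - (P.z k).2) with hs
    have column : ∀ p, Ψ p = P.z k → p.1 = (P.z k).1 := fun p hp => by rw [← hp, fst]
    have ball : ∀ p, Ψ p = P.z k → dist (P.stack α δ K k p) (P.z k) ≤ δ k := fun p hp => by
      rw [← P.dist_Lam_le_iff α h0 h1 le_rfl, ← col k hk p (column p hp), hp, dist_self]
      exact h0.le
    have hU0 : ∀ p, Ψ p = P.z k → |P.hInv α (δ k) (s p)| ≤ 1 / 2 := fun p hp => by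
      refine P.abs_le_half_of_h_zero α (P.hInv_mem α habs (smem _)) ?_
      have := P.coord_Lam α h0 h1 (ball p hp)
      rw [← col k hk p (column p hp), hp, sub_self, coord_zero, stack_fst, column p hp, sub_self,
        coord_zero] at this
      exact this.symm
    -- The flat part of `h_0` is `[-1/2, 1/2]`, whereas the horizontal sides of the square have `|U|
    -- = (1 + δ k)/2`. So the collapsed arc lies inside the open square, and nearby points remain in
    -- it.
    have slt : ∀ p, Ψ p = P.z k → |s p| < δ k := fun p hp => by
      refine lt_of_le_of_ne ((P.mem_ball_iff).1 (ball p hp)).2 fun e => ?_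
      have u := hU0 p hp
      have v := P.hInv_self α h0 (by linarith)
      rcases (abs_eq h0.le).1 e with e | e
      · rw [e, v.1, abs_of_pos (by linarith)] at u
        linarith
      · rw [e, v.2, abs_neg, abs_of_pos (by linarith)] at u
        linarith
    have cs : Continuous fun p => (P.stack α δ K k p).2 - (P.z k).2 :=
      (continuous_snd.comp (h.continuous_stack α)).sub continuous_const
    refine ⟨fun p => P.hInv α (δ k) (s p), fun p => P.hInv_mem α habs (smem _), fun p hp => ?_,
      fun p q hp hq hpq => ?_, fun p₀ hp₀ η hη => ?_⟩
    · have hsp := abs_lt.1 (slt p hp)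
      refine ContinuousAt.comp (f := s) ((P.continuousOn_hInv α h0.ne' habs).continuousAt
        (Icc_mem_nhds (by linarith) (by linarith))) ?_
      refine ContinuousAt.comp (f := fun p => (P.stack α δ K k p).2 - (P.z k).2)
        (continuousAt_coord ?_) cs.continuousAt
      rw [norm_eq_abs_coord]
      exact (slt p hp).trans h1
    · have e := congrArg (P.h α (δ k)) hpq
      simp only [P.h_hInv α habs (smem _), hs] at e
      refine injk k p q (column p hp) (Prod.ext ?_ (sub_left_injective (coord_injective e)))
      rw [stack_fst, stack_fst, column p hp, column q hq]
    · have near : ∀ᶠ p in 𝓝 p₀, dist (P.stack α δ K k p) (P.z k) < δ k := by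
        have c : Continuous fun p => dist (P.stack α δ K k p) (P.z k) :=
          (h.continuous_stack α).dist continuous_const
        refine c.tendsto p₀ (gt_mem_nhds ?_)
        rw [Prod.dist_eq, max_lt_iff, stack_fst, column p₀ hp₀, dist_self, dist_eq_norm,
          norm_eq_abs_coord]
        exact ⟨h0, slt p₀ hp₀⟩
      have q1 : ∀ᶠ p in 𝓝 p₀, ‖(Ψ p).2 - (P.z k).2‖ < 1 / 4 := by
        have c : Continuous fun p => ‖(Ψ p).2 - (P.z k).2‖ := by fun_prop
        refine c.tendsto p₀ (gt_mem_nhds ?_)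
        rw [hp₀, sub_self, norm_zero]
        norm_num
      have q2 : ∀ᶠ p in 𝓝 p₀, ‖(P.stack α δ K (k + 1) p).2 - (P.z k).2‖ < 1 / 4 := by
        have c : Continuous fun p => ‖(P.stack α δ K (k + 1) p).2 - (P.z k).2‖ :=
          ((continuous_snd.comp (h.continuous_stack α)).sub continuous_const).norm
        refine c.tendsto p₀ (gt_mem_nhds ?_)
        rw [stack_succ_of_mem _ _ _ hk, ← col k hk p₀ (column p₀ hp₀), hp₀, sub_self, norm_zero]
        norm_num
      filter_upwards [near, q1, q2, h.eventually_dist_stack_le (α := α) (K := K) (column p₀ hp₀) hη]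
        with p b1 b2 b3 b4
      have e := P.coord_Lam α h0 h1 b1.le
      rw [← stack_succ_of_mem _ _ _ hk, stack_fst] at e
      change |_ - P.h α (coord (p.1 - (P.z k).1)) (P.hInv α (δ k) (s p))| ≤ _
      rw [← e, abs_coord_sub_coord b2.le b3.le, dist_sub_right]
      refine le_trans (le_max_right (dist (Ψ p).1 (P.stack α δ K (k + 1) p).1) _) ?_
      rw [← Prod.dist_eq]
      refine le_of_tendsto ((hlim p).dist tendsto_const_nhds) ?_
      filter_upwards [eventually_gt_atTop k] with n hn using b4 n hn

end ReesData

/-! ### The limit map, its lifts, minimality and conjugacy -/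

namespace ReesData

variable {P : ReesData} {α β : ℕ → unitInterval} {δ δ' : ℕ → ℝ}

theorem add_mem_X {w : Torus} {π : ℕ → ℕ} (hπ : ∀ k, P.z k + w = P.z (π k))
    (hs : Function.Surjective π) {p : Torus} (hp : p ∈ P.X) : p + w ∈ P.X := by
  intro n hn
  obtain ⟨j, rfl⟩ := hs n
  rw [← hπ, Prod.fst_add, Prod.fst_add] at hn
  exact hp j (add_right_cancel hn)

theorem Tame.dist_stack_le (h : P.Tame δ) (h2 : ∀ n, δ n < 1 / 2 ^ n) {K : Set ℕ} {M N : ℕ}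
    (hMN : M ≤ N) (p : Torus) :
    dist (P.stack α δ K N p) (P.stack α δ K M p) ≤ 4 / 2 ^ M := by
  have key : dist (P.stack α δ K N p) (P.stack α δ K M p) ≤ 4 / 2 ^ M - 4 / 2 ^ N := by
    induction N, hMN using Nat.le_induction with
    | base => simp
    | succ N hN ih =>
      have tri := dist_triangle (P.stack α δ K (N + 1) p) (P.stack α δ K N p) (P.stack α δ K M p)
      have mv := h.dist_stack_succ_le (P := P) α (K := K) (n := N) p
      have e : (4 : ℝ) / 2 ^ N = 2 * (4 / 2 ^ (N + 1)) := by field_simp; ring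
      have e' : (4 : ℝ) / 2 ^ N = 4 * (1 / 2 ^ N) := by ring
      linarith [h2 N]
  have : (0 : ℝ) ≤ 4 / 2 ^ N := by positivity
  linarith

theorem tendsto_four_div_two_pow : Tendsto (fun n : ℕ => (4 : ℝ) / 2 ^ n) atTop (𝓝 0) := by
  simpa [div_eq_mul_inv] using
    (tendsto_pow_atTop_nhds_zero_of_lt_one (r := (2 : ℝ)⁻¹) (by norm_num) (by norm_num)).const_mul 4

namespace Admissible

variable (hA : P.Admissible α δ)
include hA

theorem tendsto_stack (p : Torus) :
    Tendsto (fun n => P.stack α δ univ n p) atTop (𝓝 (P.Phi α δ p)) := by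
  have hc : CauchySeq fun n => P.stack α δ univ n p :=
    cauchySeq_of_le_tendsto_0' (fun n : ℕ => (4 : ℝ) / 2 ^ n)
      (fun n m hnm => by
        rw [dist_comm]
        exact hA.tame.dist_stack_le hA.lt_two_pow hnm p) tendsto_four_div_two_pow
  obtain ⟨w, hw⟩ := cauchySeq_tendsto_of_complete hc
  have : Tendsto (fun n => P.PhiSeq α δ n p) atTop (𝓝 w) := by
    simp only [hA.tame.PhiSeq_eq_stack]
    exact hw.comp (tendsto_add_atTop_nat 1)
  rwa [Phi, this.limUnder_eq]

theorem dist_Phi_stack_le (n : ℕ) (p : Torus) :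
    dist (P.Phi α δ p) (P.stack α δ univ n p) ≤ 4 / 2 ^ n := by
  refine le_of_tendsto ((hA.tendsto_stack p).dist tendsto_const_nhds) ?_
  filter_upwards [eventually_ge_atTop n] with m hm
  exact hA.tame.dist_stack_le hA.lt_two_pow hm p

theorem continuous_Phi : Continuous (P.Phi α δ) := by
  have : TendstoUniformly (fun n => P.stack α δ univ n) (P.Phi α δ) atTop := by
    rw [Metric.tendstoUniformly_iff]
    intro ε hε
    filter_upwards [tendsto_four_div_two_pow.eventually (gt_mem_nhds hε)] with n hn p
    exact (hA.dist_Phi_stack_le n p).trans_lt hn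
  exact this.continuous (Frequently.of_forall fun n => hA.tame.continuous_stack α)

theorem Phi_fst (p : Torus) : (P.Phi α δ p).1 = p.1 := by
  refine tendsto_nhds_unique ((continuous_fst.tendsto _).comp (hA.tendsto_stack p)) ?_
  simp only [Function.comp_def, stack_fst]
  exact tendsto_const_nhds

theorem Phi_mem_X_iff {p : Torus} : P.Phi α δ p ∈ P.X ↔ p ∈ P.X := by
  simp only [X, mem_ofPred_eq, hA.Phi_fst]

/-- Once `1/n ≤ d(p, q)`, the later stages shrink the distance of the images at stage `n` by a total
factor of at least `c > 0`, and that stage separates `p ∈ X` from every other point. -/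
theorem Phi_injective {p q : Torus} (hp : p ∈ P.X) (hpq : P.Phi α δ p = P.Phi α δ q) : p = q := by
  by_contra hne
  obtain ⟨n₀, hn₀⟩ := exists_nat_one_div_lt (dist_pos.2 hne)
  set n := n₀ + 1
  obtain ⟨a, ha, ⟨c, hc, hlim⟩, hexp⟩ := hA.expansion
  have f0 : ∀ r, 0 ≤ 1 - 1 / (a r : ℝ) := fun r => by
    rw [sub_nonneg, div_le_one (by exact_mod_cast (by linarith [ha r]))]
    exact_mod_cast (by linarith [ha r])
  have f1 : ∀ r, 1 - 1 / (a r : ℝ) ≤ 1 := fun r => by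
    rw [sub_le_self_iff]
    positivity
  have anti : Antitone fun N => ∏ r ∈ Finset.Icc 1 N, (1 - 1 / (a r : ℝ)) := by
    refine antitone_nat_of_succ_le fun N => ?_
    rw [Finset.prod_Icc_succ_top (by omega)]
    exact mul_le_of_le_one_right (Finset.prod_nonneg fun r _ => f0 r) (f1 _)
  have hprod : ∀ m, c ≤ ∏ r ∈ Finset.Icc (n + 1) m, (1 - 1 / (a r : ℝ)) := fun m => by
    refine (anti.le_of_tendsto hlim m).trans ?_
    rw [← Finset.prod_sdiff (Finset.Icc_subset_Icc_left (by omega : 1 ≤ n + 1))]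
    exact mul_le_of_le_one_left (Finset.prod_nonneg fun r _ => f0 r)
      (Finset.prod_le_one (fun r _ => f0 r) fun r _ => f1 r)
  have hle : c * dist (P.PhiSeq α δ n p) (P.PhiSeq α δ n q) ≤ 0 := by
    have l : Tendsto (fun m => dist (P.PhiSeq α δ m p) (P.PhiSeq α δ m q)) atTop (𝓝 0) := by
      rw [← dist_self (P.Phi α δ p)]
      nth_rw 2 [hpq]
      simp only [hA.tame.PhiSeq_eq_stack]
      exact ((hA.tendsto_stack p).comp (tendsto_add_atTop_nat 1)).dist
        ((hA.tendsto_stack q).comp (tendsto_add_atTop_nat 1))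
    refine ge_of_tendsto l ?_
    filter_upwards [eventually_gt_atTop n] with m hm
    refine le_trans ?_ (hexp n m (by omega) hm p q ?_)
    · exact mul_le_mul_of_nonneg_right (hprod m) dist_nonneg
    · refine le_trans (le_of_eq ?_) hn₀.le
      push_cast [n]
      rfl
  have hd : dist (P.PhiSeq α δ n p) (P.PhiSeq α δ n q) = 0 :=
    le_antisymm (by nlinarith) dist_nonneg
  rw [dist_eq_zero, hA.tame.PhiSeq_eq_stack, hA.tame.PhiSeq_eq_stack] at hd
  exact hne (hA.tame.stack_injective α (fun k _ _ => hp k) hd)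

theorem Phi_surjective : Function.Surjective (P.Phi α δ) := by
  intro w
  have hcl : IsClosed (range (P.Phi α δ)) := (isCompact_range hA.continuous_Phi).isClosed
  rw [← mem_range, ← hcl.closure_eq, Metric.mem_closure_iff]
  intro ε hε
  obtain ⟨n, hn⟩ := (tendsto_four_div_two_pow.eventually (gt_mem_nhds hε)).exists
  obtain ⟨p, rfl⟩ := hA.tame.stack_surjective (P := P) α (K := univ) (n := n) w
  refine ⟨_, mem_range_self p, ?_⟩
  rw [dist_comm]
  exact (hA.dist_Phi_stack_le n p).trans_lt hn

theorem bijOn_Phi : BijOn (P.Phi α δ) P.X P.X := by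
  refine ⟨fun p hp => hA.Phi_mem_X_iff.2 hp, fun p hp q _ h => hA.Phi_injective hp h, fun w hw => ?_⟩
  obtain ⟨p, rfl⟩ := hA.Phi_surjective w
  exact ⟨p, hA.Phi_mem_X_iff.1 hw, rfl⟩

theorem collapse : P.Collapse α (P.Phi α δ) univ :=
  hA.tame.collapse hA.continuous_Phi hA.tendsto_stack fun _ _ _ hk h =>
    hA.Phi_injective (fun k => hk k (mem_univ k)) h

/-- Translations that permute the points `z k` lift to continuous maps. -/
theorem exists_lift (hB : P.Admissible β δ') (hαβ : C0Rel α β) {w : Torus} {π : ℕ → ℕ}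
    (hπ : ∀ k, P.z k + w = P.z (π k)) (hs : Function.Surjective π) :
    ∃ F : Torus → Torus, Continuous F ∧ ∀ p, P.Phi β δ' (F p) = P.Phi α δ p + w := by
  have hH : ∀ p ∈ P.X, P.Phi β δ' (Function.invFunOn (P.Phi β δ') P.X (P.Phi α δ p + w)) =
      P.Phi α δ p + w := fun p hp =>
    Function.invFunOn_eq (hB.bijOn_Phi.surjOn (add_mem_X hπ hs (hA.Phi_mem_X_iff.2 hp)))
  obtain ⟨F, hF, hFH⟩ := hA.collapse.exists_extension hB.collapse hαβ hπ
    (fun k _ => (hs k).imp fun _ h => ⟨mem_univ _, h⟩) hH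
  refine ⟨F, hF, fun p => ?_⟩
  have : Continuous fun p => P.Phi α δ p + w := hA.continuous_Phi.add continuous_const
  refine congrFun ((hB.continuous_Phi.comp hF).ext_on P.dense_X this fun p hp => ?_) p
  rw [Function.comp_apply, hFH hp, hH p hp]

/-- Such lifts are homeomorphisms. -/
theorem exists_lift_homeomorph (hB : P.Admissible β δ') (hαβ : C0Rel α β) {w : Torus} {π ρ : ℕ → ℕ}
    (hπ : ∀ k, P.z k + w = P.z (π k)) (hπρ : Function.RightInverse ρ π)
    (hρπ : Function.LeftInverse ρ π) :
    ∃ F : Torus ≃ₜ Torus, ∀ p, P.Phi β δ' (F p) = P.Phi α δ p + w := by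
  have hρ : ∀ k, P.z k + -w = P.z (ρ k) := fun k => by
    rw [← sub_eq_add_neg, sub_eq_iff_eq_add, hπ, hπρ]
  have hβα : C0Rel β α := by
    unfold C0Rel at hαβ ⊢
    simpa only [abs_sub_comm] using hαβ
  obtain ⟨F, hF, hFΦ⟩ := hA.exists_lift hB hαβ hπ hπρ.surjective
  obtain ⟨G, hG, hGΦ⟩ := hB.exists_lift hA hβα hρ hρπ.surjective
  -- The composite lifts the identity translation, so it fixes `X` by injectivity of `Φ` there, and
  -- hence everything by density.
  have left : G ∘ F = id := (hG.comp hF).ext_on P.dense_X continuous_id fun p hp => by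
    refine (hA.Phi_injective hp ?_).symm
    rw [Function.comp_apply, hGΦ, hFΦ, add_neg_cancel_right]
  have right : F ∘ G = id := (hF.comp hG).ext_on P.dense_X continuous_id fun p hp => by
    refine (hB.Phi_injective hp ?_).symm
    rw [Function.comp_apply, hFΦ, hGΦ, neg_add_cancel_right]
  exact ⟨⟨⟨F, G, congrFun left, congrFun right⟩, hF, hG⟩, hFΦ⟩

theorem Phi_system {S : Torus ≃ₜ Torus} (hS : P.IsSystem α δ S) (p : Torus) :
    P.Phi α δ (S p) = P.T (P.Phi α δ p) := by
  refine congrFun ((hA.continuous_Phi.comp S.continuous).ext_on P.dense_X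
    (P.T.continuous.comp hA.continuous_Phi) fun p hp => ?_) p
  rw [Function.comp_apply, hS.2 hp]
  exact Function.invFunOn_eq (hA.bijOn_Phi.surjOn (P.T_mem_X (hA.Phi_mem_X_iff.2 hp)))

theorem isSystem_of_Phi {S : Torus ≃ₜ Torus} (hS : ∀ p, P.Phi α δ (S p) = P.T (P.Phi α δ p)) :
    P.IsSystem α δ S := by
  refine ⟨hA.bijOn_Phi, fun p hp => ?_⟩
  have hSp : S p ∈ P.X := by
    rw [← hA.Phi_mem_X_iff, hS]
    exact P.T_mem_X (hA.Phi_mem_X_iff.2 hp)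
  have := hA.bijOn_Phi.injOn.leftInvOn_invFunOn hSp
  rw [hS] at this
  exact this.symm

theorem existsUnique_system : ∃! S : Torus ≃ₜ Torus, P.IsSystem α δ S := by
  obtain ⟨S, hS⟩ := hA.exists_lift_homeomorph hA (by simp [C0Rel]) (w := P.v) (π := σ) (ρ := τ)
    P.T_z σ_τ τ_σ
  refine ⟨S, hA.isSystem_of_Phi hS, fun S' hS' => ?_⟩
  refine Homeomorph.ext (congrFun (S'.continuous.ext_on P.dense_X S.continuous fun p hp => ?_))
  rw [hS'.2 hp, (hA.isSystem_of_Phi hS).2 hp]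

theorem isMinimalHomeo {S : Torus ≃ₜ Torus} (hS : P.IsSystem α δ S) : IsMinimalHomeo S := by
  intro p
  have hΦ := hA.Phi_system hS
  have hΦs : ∀ p, P.Phi α δ ((S ^ (-1 : ℤ)) p) = (P.T ^ (-1 : ℤ)) (P.Phi α δ p) := fun p => by
    rw [zpow_neg_one, zpow_neg_one]
    change P.Phi α δ (S.symm p) = P.T.symm (P.Phi α δ p)
    rw [Homeomorph.eq_symm_apply, ← hΦ, Homeomorph.apply_symm_apply]
  have hpow : ∀ n : ℤ, ∀ p, P.Phi α δ ((S ^ n) p) = (P.T ^ n) (P.Phi α δ p) := by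
    intro n
    induction n using Int.induction_on with
    | zero => intro p; simp
    | succ n ih =>
      intro p
      rw [zpow_add, zpow_add, zpow_one, zpow_one, Homeomorph.mul_apply, Homeomorph.mul_apply, ih, hΦ]
    | pred n ih =>
      intro p
      rw [sub_eq_add_neg, zpow_add, zpow_add, Homeomorph.mul_apply, Homeomorph.mul_apply, ih, hΦs]
  rw [← dense_closure]
  refine P.dense_X.mono fun x hx => ?_
  -- The image of the orbit closure is compact and contains a dense orbit of the rotation, so it is
  -- the whole torus. Over `X` preimages are unique, hence the orbit closure contains `X`.
  have hcl : IsClosed (P.Phi α δ '' closure (range fun n : ℤ => (S ^ n) p)) :=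
    (isClosed_closure.isCompact.image hA.continuous_Phi).isClosed
  have hsub : closure (range fun n : ℤ => (P.T ^ n) (P.Phi α δ p)) ⊆
      P.Phi α δ '' closure (range fun n : ℤ => (S ^ n) p) := by
    refine closure_minimal ?_ hcl
    rintro _ ⟨n, rfl⟩
    exact ⟨(S ^ n) p, subset_closure (mem_range_self n), hpow n p⟩
  obtain ⟨y, hy, hyx⟩ := hsub (P.rotation_minimal (P.Phi α δ p) (P.Phi α δ x))
  rwa [hA.Phi_injective hx hyx.symm]

theorem topConjugate (hB : P.Admissible β δ') (hαβ : C0Rel α β) {S S' : Torus ≃ₜ Torus}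
    (hS : P.IsSystem α δ S) (hS' : P.IsSystem β δ' S') : TopConjugate S S' := by
  obtain ⟨F, hF⟩ := hA.exists_lift_homeomorph hB hαβ (w := 0) (π := id) (ρ := id)
    (fun k => add_zero _) (fun _ => rfl) (fun _ => rfl)
  simp only [add_zero] at hF
  refine ⟨F, congrFun ((F.continuous.comp S.continuous).ext_on P.dense_X
    (S'.continuous.comp F.continuous) fun p hp => ?_)⟩
  refine hB.Phi_injective ?_ ?_
  · rw [Function.comp_apply, ← hB.Phi_mem_X_iff, hF, hA.Phi_system hS]
    exact P.T_mem_X (hA.Phi_mem_X_iff.2 hp)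
  · simp only [Function.comp_apply]
    rw [hF, hA.Phi_system hS, hB.Phi_system hS', hF]

end Admissible

end ReesData

namespace ReesData

variable {P : ReesData} {α : ℕ → unitInterval} {δ : ℕ → ℝ} {K : Set ℕ}

/-! ### Conjugation of finite stages -/

theorem stack_eq_of_le {M N : ℕ} (hK : ∀ i ∈ K, i < M) (hMN : M ≤ N) (p : Torus) :
    P.stack α δ K N p = P.stack α δ K M p := by
  induction N, hMN using Nat.le_induction with
  | base => rfl
  | succ N hN ih => rw [stack_succ_of_notMem _ _ _ fun h => absurd (hK N h) (by omega), ih]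

theorem Tame.collapse_stack (h : P.Tame δ) {N : ℕ} (hK : ∀ i ∈ K, i < N) :
    P.Collapse α (P.stack α δ K N) K := by
  refine h.collapse (h.continuous_stack α) (fun p => ?_) fun p q _ hp hpq =>
    h.stack_injective α (fun k hk _ => hp k hk) hpq
  refine tendsto_const_nhds.congr' ?_
  filter_upwards [eventually_ge_atTop N] with m hm using (stack_eq_of_le hK hm p).symm

section conjugate

variable {w : Torus} {π : ℕ → ℕ} (h : P.Tame δ) (hπ : ∀ k, P.z k + w = P.z (π k))
  (hb : Function.Bijective π) (hnear : ∀ n, π n ≤ n + 2 ∧ n ≤ π n + 2)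

variable (P α δ w π) in
/-- The conjugate of the translation by `w` by a finite stage of the construction. -/
noncomputable def conj (n : ℕ) (p : Torus) : Torus :=
  Function.invFunOn (P.PhiPerm α δ π n) P.X (P.PhiSeq α δ n p + w)

include h hb

include hnear in
theorem Tame.PhiPerm_eq (n : ℕ) : P.PhiPerm α δ π n = P.stack α δ (π '' Iic n) (n + 3) :=
  funext fun p => h.PhiPerm_eq_stack α hb.1 hnear n (fun i hi => by have := hnear i; omega) p

include hnear in
theorem Tame.bijOn_PhiPerm (n : ℕ) : BijOn (P.PhiPerm α δ π n) P.X P.X := by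
  rw [h.PhiPerm_eq hb hnear]
  exact h.bijOn_stack α

include hπ

theorem Tame.PhiSeq_add_mem {n : ℕ} {p : Torus} (hp : p ∈ P.X) : P.PhiSeq α δ n p + w ∈ P.X := by
  refine add_mem_X hπ hb.2 ?_
  rw [h.PhiSeq_eq_stack]
  exact (h.bijOn_stack α).mapsTo hp

include hnear

theorem Tame.PhiPerm_conj {n : ℕ} {p : Torus} (hp : p ∈ P.X) :
    P.PhiPerm α δ π n (P.conj α δ w π n p) = P.PhiSeq α δ n p + w :=
  Function.invFunOn_eq ((h.bijOn_PhiPerm hb hnear n).surjOn (h.PhiSeq_add_mem hπ hb hp))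

theorem Tame.conj_mem {n : ℕ} {p : Torus} (hp : p ∈ P.X) : P.conj α δ w π n p ∈ P.X :=
  Function.invFunOn_mem ((h.bijOn_PhiPerm hb hnear n).surjOn (h.PhiSeq_add_mem hπ hb hp))

/-- Both finite stages are collapsing maps, with index sets matched by `π`, so the lift extends
continuously to the compact torus. -/
theorem Tame.uniformContinuousOn_conj (n : ℕ) : UniformContinuousOn (P.conj α δ w π n) P.X := by
  have c₁ : P.Collapse α (P.PhiSeq α δ n) (Iic n) := by
    have : P.PhiSeq α δ n = P.stack α δ (Iic n) (n + 1) := funext fun p => by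
      rw [h.PhiSeq_eq_stack]
      exact P.stack_congr α δ (fun _ _ => rfl) (fun i hi => by simp; omega) p
    rw [this]
    exact h.collapse_stack fun i hi => Nat.lt_succ_of_le hi
  have c₂ : P.Collapse α (P.PhiPerm α δ π n) (π '' Iic n) := by
    rw [h.PhiPerm_eq hb hnear]
    refine h.collapse_stack ?_
    rintro _ ⟨i, hi, rfl⟩
    have := hnear i
    simp only [mem_Iic] at hi
    omega
  refine c₁.uniformContinuousOn c₂ (by simp [C0Rel]) hπ ?_ fun p hp => h.PhiPerm_conj hπ hb hnear hp
  rintro _ ⟨i, hi, rfl⟩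
  exact ⟨i, hi, rfl⟩

end conjugate

/-! ### The choice of the squares -/

variable (P α δ) in
/-- The conditions on the half-side `r` of the `n`-th square, given the preceding ones. -/
structure Choice (n : ℕ) (r : ℝ) : Prop where
  pos : 0 < r
  lt_pow : r < 1 / 2 ^ (n + 1)
  le_prev : ∀ m < n, r ≤ δ m
  lt_z : ∀ a ∈ Finset.range (n + 6), ∀ b ∈ Finset.range (n + 6), a ≠ b →
    r < dist (P.z a) (P.z b) / 2
  lt_x : ∀ m ∈ Finset.range n, r < dist (P.z m).1 (P.z n).1 / (n + 1)
  fibre : 0 < n → ∀ p q : Torus, p.1 = (P.z n).1 → q.1 = (P.z n).1 →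
    dist (P.stack α δ univ n p) (P.stack α δ univ n q) ≤ r → dist p q < 1 / (n : ℝ)
  expand : 0 < n → ∀ p q : Torus, 1 / (n : ℝ) ≤ dist p q →
    dist (P.stack α δ univ n p) (P.z n) ≤ r →
      4 * r * (n + 2) ^ 2 ≤ dist (P.stack α δ univ n p) (P.stack α δ univ n q)
  preimage : ∀ F ∈ (Finset.range n).powerset, ∀ j ∈ Finset.range (n + 6), j ∉ F → ∀ p q : Torus,
    dist (P.stack α δ (F : Set ℕ) n p) (P.z j) ≤ r →
      dist (P.stack α δ (F : Set ℕ) n q) (P.z j) ≤ r → dist p q < 1 / 2 ^ n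

theorem Choice.congr {n : ℕ} {r : ℝ} {δ' : ℕ → ℝ} (h : P.Choice α δ n r)
    (hδ : ∀ i < n, δ i = δ' i) : P.Choice α δ' n r := by
  have e : ∀ K : Set ℕ, P.stack α δ' K n = P.stack α δ K n := fun K => funext fun p =>
    (P.stack_congr α δ hδ (fun _ _ => Iff.rfl) p).symm
  refine ⟨h.pos, h.lt_pow, fun m hm => hδ m hm ▸ h.le_prev m hm, h.lt_z, h.lt_x, ?_, ?_, ?_⟩
  · simpa only [e] using h.fibre
  · simpa only [e] using h.expand
  · simpa only [e] using h.preimage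

/-- On the compact set of pairs at distance at least `η`, the larger distance of the two images to
`w` is positive, hence bounded below. -/
theorem exists_pos_preimage {Φ : Torus → Torus} (hΦ : Continuous Φ) {w : Torus}
    (hinj : ∀ p q, Φ p = w → Φ q = w → p = q) {η : ℝ} (hη : 0 < η) :
    ∃ ρ > 0, ∀ p q, dist (Φ p) w < ρ → dist (Φ q) w < ρ → dist p q < η := by
  have hK : IsCompact {x : Torus × Torus | η ≤ dist x.1 x.2} :=
    (isClosed_le continuous_const (by fun_prop)).isCompact
  have hf : Continuous fun x : Torus × Torus => max (dist (Φ x.1) w) (dist (Φ x.2) w) := by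
    fun_prop
  obtain ⟨ρ, hρ, hle⟩ := hK.exists_forall_le' hf.continuousOn (a := 0) fun x hx => by
    by_contra! hm
    have := hinj x.1 x.2 (dist_le_zero.1 ((le_max_left _ _).trans hm))
      (dist_le_zero.1 ((le_max_right _ _).trans hm))
    rw [mem_ofPred_eq, this, dist_self] at hx
    linarith
  refine ⟨ρ, hρ, fun p q hp hq => ?_⟩
  by_contra! hpq
  exact absurd (hle (p, q) hpq) (not_le.2 (max_lt hp hq))

theorem exists_pos_fibre {Φ : Torus → Torus} (hΦ : Continuous Φ) {c : UnitAddCircle}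
    (hinj : ∀ p q : Torus, p.1 = c → q.1 = c → Φ p = Φ q → p = q) {η : ℝ} (hη : 0 < η) :
    ∃ ρ > 0, ∀ p q : Torus, p.1 = c → q.1 = c → dist (Φ p) (Φ q) < ρ → dist p q < η := by
  have hK : IsCompact ({x : Torus × Torus | x.1.1 = c} ∩ ({x : Torus × Torus | x.2.1 = c} ∩
      {x : Torus × Torus | η ≤ dist x.1 x.2})) :=
    ((isClosed_eq (by fun_prop) continuous_const).inter ((isClosed_eq (by fun_prop)
      continuous_const).inter (isClosed_le continuous_const (by fun_prop)))).isCompact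
  have hf : Continuous fun x : Torus × Torus => dist (Φ x.1) (Φ x.2) := by fun_prop
  obtain ⟨ρ, hρ, hle⟩ := hK.exists_forall_le' hf.continuousOn (a := 0) fun x hx => by
    refine dist_pos.2 fun e => ?_
    have := hinj x.1 x.2 hx.1 hx.2.1 e
    have h2 : η ≤ dist x.1 x.2 := hx.2.2
    rw [this, dist_self] at h2
    linarith
  refine ⟨ρ, hρ, fun p q hp hq hd => ?_⟩
  by_contra! hpq
  exact absurd (hle (p, q) ⟨hp, hq, hpq⟩) (not_le.2 hd)

/-- Every condition holds for all sufficiently small `r`, and there are finitely many. The analytic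
ones use compactness and the injectivity of the stage over a point not yet collapsed. Allowing all
finite `F` and all nearby `j` lets `preimage` serve both `σ` and `τ`. -/
theorem Short.exists_choice (h : Short δ) (n : ℕ) : ∃ r, P.Choice α δ n r := by
  have small : ∀ ρ : ℝ, 0 < ρ → ∀ᶠ r in 𝓝[>] (0 : ℝ), r < ρ := fun ρ hρ =>
    nhdsWithin_le_nhds (Iio_mem_nhds hρ)
  have zinj : ∀ {a b : ℕ}, a ≠ b → P.z a ≠ P.z b := fun hab e =>
    hab (P.x_injective (congrArg Prod.fst e))
  have inj : ∀ (K : Set ℕ) (j : ℕ), (∀ k ∈ K, k < n → k ≠ j) → ∀ p q : Torus, p.1 = (P.z j).1 →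
      P.stack α δ K n p = P.stack α δ K n q → p = q := fun K j hj p q hp =>
    h.stack_injective α fun k hk hkn e => hj k hk hkn (P.x_injective (e.symm.trans hp))
  have above : ∀ (K : Set ℕ) (j : ℕ), (∀ k ∈ K, k < n → k ≠ j) → ∀ p q : Torus,
      P.stack α δ K n p = P.z j → P.stack α δ K n q = P.z j → p = q := fun K j hj p q hp hq =>
    inj K j hj p q (by rw [← hp, stack_fst]) (hp.trans hq.symm)
  have e1 : ∀ᶠ r in 𝓝[>] (0 : ℝ), ∀ m ∈ Finset.range n, r ≤ δ m :=
    (Finset.eventually_all _).2 fun m _ => (small _ (h.pos m)).mono fun r hr => hr.le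
  have e2 : ∀ᶠ r in 𝓝[>] (0 : ℝ), ∀ a ∈ Finset.range (n + 6), ∀ b ∈ Finset.range (n + 6), a ≠ b →
      r < dist (P.z a) (P.z b) / 2 := by
    refine (Finset.eventually_all _).2 fun a _ => (Finset.eventually_all _).2 fun b _ => ?_
    by_cases hab : a = b
    · exact Eventually.of_forall fun r hr => absurd hab hr
    · exact (small _ (half_pos (dist_pos.2 (zinj hab)))).mono fun r hr _ => hr
  have e3 : ∀ᶠ r in 𝓝[>] (0 : ℝ), ∀ m ∈ Finset.range n, r < dist (P.z m).1 (P.z n).1 / (n + 1) := by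
    refine (Finset.eventually_all _).2 fun m hm => small _ (div_pos (dist_pos.2 fun e => ?_)
      (by positivity))
    have := P.x_injective e
    rw [Finset.mem_range] at hm
    omega
  have e4 : ∀ᶠ r in 𝓝[>] (0 : ℝ), 0 < n → ∀ p q : Torus, p.1 = (P.z n).1 → q.1 = (P.z n).1 →
      dist (P.stack α δ univ n p) (P.stack α δ univ n q) ≤ r → dist p q < 1 / (n : ℝ) := by
    rcases Nat.eq_zero_or_pos n with h0 | h0
    · exact Eventually.of_forall fun r hr => absurd hr (by omega)
    · obtain ⟨ρ, hρ, H⟩ := exists_pos_fibre (h.continuous_stack α (P := P) (K := univ) (n := n))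
        (c := (P.z n).1) (fun p q hp _ => inj univ n (fun k _ hk => hk.ne) p q hp)
        (η := 1 / (n : ℝ)) (by positivity)
      exact (small ρ hρ).mono fun r hr _ p q hp hq hd => H p q hp hq (hd.trans_lt hr)
  have e5 : ∀ᶠ r in 𝓝[>] (0 : ℝ), 0 < n → ∀ p q : Torus, 1 / (n : ℝ) ≤ dist p q →
      dist (P.stack α δ univ n p) (P.z n) ≤ r →
        4 * r * (n + 2) ^ 2 ≤ dist (P.stack α δ univ n p) (P.stack α δ univ n q) := by
    rcases Nat.eq_zero_or_pos n with h0 | h0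
    · exact Eventually.of_forall fun r hr => absurd hr (by omega)
    · obtain ⟨ρ, hρ, H⟩ := exists_pos_preimage (h.continuous_stack α (P := P) (K := univ) (n := n))
        (w := P.z n) (above univ n fun k _ hk => hk.ne) (η := 1 / (n : ℝ)) (by positivity)
      -- Here `q` maps outside the `ρ`-ball and `p` inside the `ρ/2`-ball, so the images are `ρ/2`
      -- apart; the second bound on `r` gives `4 r (n + 2)² < ρ/2`.
      filter_upwards [small (ρ / 2) (by positivity), small (ρ / (8 * (n + 2) ^ 2)) (by positivity)]
        with r hr hr' _ p q hpq hp
      have hq : ρ ≤ dist (P.stack α δ univ n q) (P.z n) := by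
        by_contra! hq
        exact absurd (H p q (by linarith) hq) (not_lt.2 hpq)
      have tri := dist_triangle_left (P.stack α δ univ n q) (P.z n) (P.stack α δ univ n p)
      rw [lt_div_iff₀ (by positivity)] at hr'
      linarith
  have e6 : ∀ᶠ r in 𝓝[>] (0 : ℝ), ∀ F ∈ (Finset.range n).powerset, ∀ j ∈ Finset.range (n + 6),
      j ∉ F → ∀ p q : Torus, dist (P.stack α δ (F : Set ℕ) n p) (P.z j) ≤ r →
        dist (P.stack α δ (F : Set ℕ) n q) (P.z j) ≤ r → dist p q < 1 / 2 ^ n := by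
    refine (Finset.eventually_all _).2 fun F _ => (Finset.eventually_all _).2 fun j _ => ?_
    by_cases hj : j ∈ F
    · exact Eventually.of_forall fun r hr => absurd hj hr
    · obtain ⟨ρ, hρ, H⟩ := exists_pos_preimage
        (h.continuous_stack α (P := P) (K := (F : Set ℕ)) (n := n)) (w := P.z j)
        (above F j fun k hk _ e => hj (e ▸ hk)) (η := 1 / 2 ^ n) (by positivity)
      exact (small ρ hρ).mono fun r hr _ p q hp hq => H p q (hp.trans_lt hr) (hq.trans_lt hr)
  have e0 : ∀ᶠ r in 𝓝[>] (0 : ℝ), 0 < r := self_mem_nhdsWithin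
  obtain ⟨r, h0, hp, h1, h2, h3, h4, h5, h6⟩ := (e0.and ((small (1 / 2 ^ (n + 1)) (by positivity)).and
    (e1.and (e2.and (e3.and (e4.and (e5.and e6))))))).exists
  exact ⟨r, h0, hp, fun m hm => h1 m (Finset.mem_range.2 hm), h2, h3, h4, h5, h6⟩

variable (P α) in
/-- The half-sides are chosen one after the other. -/
noncomputable def chosen : ℕ → ℕ → ℝ
  | 0 => fun _ => 1 / 4
  | n + 1 => Function.update (chosen n) n (Classical.epsilon fun r => P.Choice α (chosen n) n r)

theorem choice_chosen {n : ℕ} (h : Short (P.chosen α n)) :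
    P.Choice α (P.chosen α n) n (P.chosen α (n + 1) n) := by
  rw [chosen, Function.update_self]
  exact Classical.epsilon_spec (h.exists_choice n)

theorem short_chosen (n : ℕ) : Short (P.chosen α n) := by
  induction n with
  | zero => exact ⟨fun n => by norm_num [chosen], fun n => by norm_num [chosen]⟩
  | succ n ih =>
    have c := choice_chosen ih
    have hp : (1 : ℝ) / 2 ^ (n + 1) ≤ 1 / 2 := by
      rw [pow_succ]
      refine one_div_le_one_div_of_le (by norm_num) ?_
      have : (1 : ℝ) ≤ 2 ^ n := one_le_pow₀ (by norm_num)
      linarith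
    have o : ∀ m, m ≠ n → P.chosen α (n + 1) m = P.chosen α n m := fun m hm => by
      rw [chosen, Function.update_of_ne hm]
    constructor <;> intro m <;> by_cases hm : m = n
    · rw [hm]
      exact c.pos
    · rw [o m hm]
      exact ih.pos m
    · rw [hm]
      exact c.lt_pow.trans_le hp
    · rw [o m hm]
      exact ih.lt_half m

theorem exists_choices (P : ReesData) (α : ℕ → unitInterval) :
    ∃ δ : ℕ → ℝ, ∀ n, P.Choice α δ n (δ n) := by
  refine ⟨fun n => P.chosen α (n + 1) n, fun n => (choice_chosen (short_chosen n)).congr fun i hi => ?_⟩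
  induction n, hi using Nat.le_induction with
  | base => rfl
  | succ n hn ih => rw [chosen, Function.update_of_ne (by omega), ih]

end ReesData

/-! ### Admissibility of the chosen squares -/

namespace ReesData

variable {P : ReesData} {α : ℕ → unitInterval} {δ : ℕ → ℝ}

section choices

variable (hc : ∀ n, P.Choice α δ n (δ n))
include hc

theorem antitone_of_choice : Antitone δ :=
  antitone_nat_of_succ_le fun n => (hc (n + 1)).le_prev n (Nat.lt_succ_self n)

theorem add_lt_of_choice {i a b : ℕ} (ha : a ≤ i + 5) (hb : b ≤ i + 5) (hab : a ≠ b) {r s : ℝ}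
    (hr : r ≤ δ i) (hs : s ≤ δ i) : r + s < dist (P.z a) (P.z b) := by
  have := (hc i).lt_z a (Finset.mem_range.2 (by omega)) b (Finset.mem_range.2 (by omega)) hab
  linarith

theorem tame_of_choice : P.Tame δ where
  pos n := (hc n).pos
  lt_half n := by
    refine (hc n).lt_pow.trans_le (one_div_le_one_div_of_le (by norm_num) ?_)
    rw [pow_succ]
    have : (1 : ℝ) ≤ 2 ^ n := one_le_pow₀ (by norm_num)
    linarith
  disjoint_near m n hmn hm hn := by
    refine disjoint_left.2 fun p hpm hpn => ?_
    rw [mem_square] at hpm hpn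
    have tri := dist_triangle_left (P.z m) (P.z n) p
    rcases le_total m n with h | h
    · linarith [add_lt_of_choice hc (i := m) (by omega) hn hmn le_rfl (antitone_of_choice hc h)]
    · linarith [add_lt_of_choice hc (i := n) hm (by omega) hmn (antitone_of_choice hc h) le_rfl]
  lt_dist n m hmn := by
    refine ((hc n).lt_x m (Finset.mem_range.2 hmn)).trans_le ?_
    have : (0 : ℝ) < n := by exact_mod_cast (Nat.zero_le m).trans_lt hmn
    exact div_le_div_of_nonneg_left dist_nonneg this (by linarith)

/-- Over a small ball about `z j`, only the squares of index `< i` matter. -/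
theorem stack_eq_of_dist_le {K : Set ℕ} {i j N : ℕ} (hj : j ≤ i + 5) (hjK : j ∉ K)
    (hK : ∀ m ∈ K, m ≤ i + 5) (hiN : i ≤ N) {p : Torus}
    (hp : dist (P.stack α δ K N p) (P.z j) ≤ δ i) : P.stack α δ K N p = P.stack α δ K i p := by
  induction N, hiN using Nat.le_induction with
  | base => rfl
  | succ N hN ih =>
    by_cases hNK : N ∈ K
    · have h := tame_of_choice hc
      rw [stack_succ_of_mem _ _ _ hNK] at hp ⊢
      have e : P.Lam α δ N (P.stack α δ K N p) = P.stack α δ K N p := by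
        refine P.Lam_of_notMem α δ fun hb => ?_
        have hb' := P.dist_Lam_le α (h.pos N) (h.lt_half N) hb
        have tri := dist_triangle_left (P.z N) (P.z j) (P.Lam α δ N (P.stack α δ K N p))
        linarith [add_lt_of_choice hc (hK N hNK) hj (fun e => hjK (e ▸ hNK))
          (antitone_of_choice hc hN) le_rfl]
      rw [e] at hp ⊢
      exact ih hp
    · rw [stack_succ_of_notMem _ _ _ hNK] at hp ⊢
      exact ih hp

variable {w : Torus} {π : ℕ → ℕ} (hπ : ∀ k, P.z k + w = P.z (π k)) (hb : Function.Bijective π)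
  (hnear : ∀ n, π n ≤ n + 2 ∧ n ≤ π n + 2)
include hπ hb hnear

/-- The two lifts agree unless the translated image lies in the ball of radius `δ i` about `z j`.
Over that ball the stage reduces to factors of index below `i`, and the preimage has diameter at
most `1 / 2 ^ i`. -/
theorem dist_conj_succ_le (n : ℕ) {p : Torus} (hp : p ∈ P.X) :
    dist (P.conj α δ w π (n + 1) p) (P.conj α δ w π n p) ≤ 2 / 2 ^ n := by
  have h := tame_of_choice hc
  have hanti := antitone_of_choice hc
  set r := P.conj α δ w π n p
  set r' := P.conj α δ w π (n + 1) p
  have e : P.PhiPerm α δ π n r = P.PhiSeq α δ n p + w := h.PhiPerm_conj hπ hb hnear hp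
  have e' : P.Lam α δ (π (n + 1)) (P.PhiPerm α δ π n r') =
      P.Lam α δ (n + 1) (P.PhiSeq α δ n p) + w :=
    h.PhiPerm_conj (α := α) (n := n + 1) hπ hb hnear hp
  have hn1 := hnear (n + 1)
  set j := π (n + 1) with hj
  set i := min j (n + 1) with hi
  have hij : δ j ≤ δ i := hanti (min_le_left _ _)
  have hin : δ (n + 1) ≤ δ i := hanti (min_le_right _ _)
  have tr : ∀ y : Torus, dist (y + w) (P.z j) = dist y (P.z (n + 1)) := fun y => by
    rw [hj, ← hπ, dist_add_right]
  -- The radius `δ i` is at least both half-sides `δ j` and `δ (n + 1)`, so both new maps preserve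
  -- the ball and its complement.
  have balls : dist (P.PhiPerm α δ π n r) (P.z j) ≤ δ i ↔
      dist (P.PhiPerm α δ π n r') (P.z j) ≤ δ i := by
    rw [← P.dist_Lam_le_iff α (h.pos j) (h.lt_half j) hij (p := P.PhiPerm α δ π n r'), e', e, tr, tr,
      P.dist_Lam_le_iff α (h.pos _) (h.lt_half _) hin]
  by_cases hin' : dist (P.PhiPerm α δ π n r) (P.z j) ≤ δ i
  · have hin'' := balls.1 hin'
    set K := π '' Iic n with hK
    have hKn : ∀ m ∈ K, m ≤ i + 5 := by
      rintro _ ⟨l, hl, rfl⟩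
      have := hnear l
      simp only [mem_Iic] at hl
      omega
    have hjK : j ∉ K := by
      rintro ⟨l, hl, e⟩
      have := hb.1 e
      simp only [mem_Iic] at hl
      omega
    rw [h.PhiPerm_eq hb hnear, ← hK] at hin' hin''
    rw [stack_eq_of_dist_le hc (by omega) hjK hKn (by omega) hin'] at hin'
    rw [stack_eq_of_dist_le hc (by omega) hjK hKn (by omega) hin''] at hin''
    classical
    set F := (Finset.range i).filter (· ∈ K) with hF
    have hFK : ∀ q, P.stack α δ K i q = P.stack α δ (F : Set ℕ) i q :=
      P.stack_congr α δ (fun _ _ => rfl) fun m hm => by simp [hF, hm]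
    rw [hFK] at hin' hin''
    have d := (hc i).preimage F (Finset.mem_powerset.2 (Finset.filter_subset _ _)) j
      (Finset.mem_range.2 (by omega)) (fun hjF => hjK (Finset.mem_filter.1 hjF).2) r' r hin'' hin'
    refine d.le.trans ?_
    rw [div_le_div_iff₀ (by positivity) (by positivity), one_mul, ← pow_succ']
    -- Since `π (n + 1) ≥ n - 1`, also `n ≤ i + 1`; this accounts for the factor 2 in the bound.
    exact pow_le_pow_right₀ (by norm_num) (by omega)
  · have hout := fun hd => hin' (balls.2 hd)
    rw [P.Lam_of_notMem α δ (fun hd => hout (hd.trans hij)), P.Lam_of_notMem α δ, ← e] at e'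
    · have hrr : r' = r := (h.bijOn_PhiPerm hb hnear n).injOn (h.conj_mem hπ hb hnear hp)
        (h.conj_mem hπ hb hnear hp) e'
      rw [hrr, dist_self]
      positivity
    · intro hd
      rw [e, tr] at hin'
      exact hin' (hd.trans hin)

theorem uniformCauchySeqOn_conj : UniformCauchySeqOn (P.conj α δ w π) atTop P.X := by
  have key : ∀ N, ∀ m ≥ N, ∀ p ∈ P.X,
      dist (P.conj α δ w π m p) (P.conj α δ w π N p) ≤ 4 / 2 ^ N - 4 / 2 ^ m := by
    intro N m hm p hp
    induction m, hm using Nat.le_induction with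
    | base => simp
    | succ m hm ih =>
      have tri := dist_triangle (P.conj α δ w π (m + 1) p) (P.conj α δ w π m p)
        (P.conj α δ w π N p)
      have step := dist_conj_succ_le hc hπ hb hnear m hp
      have e : (4 : ℝ) / 2 ^ m = 2 * (4 / 2 ^ (m + 1)) := by field_simp; ring
      have e' : (4 : ℝ) / 2 ^ m = 2 * (2 / 2 ^ m) := by ring
      linarith
  rw [Metric.uniformCauchySeqOn_iff]
  intro ε hε
  obtain ⟨N, hN⟩ := (tendsto_four_div_two_pow.eventually (gt_mem_nhds (half_pos hε))).exists
  refine ⟨N, fun m hm n hn p hp => ?_⟩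
  have a := key N m hm p hp
  have b := key N n hn p hp
  have a' : (0 : ℝ) < 4 / 2 ^ m := by positivity
  have b' : (0 : ℝ) < 4 / 2 ^ n := by positivity
  have tri := dist_triangle_right (P.conj α δ w π m p) (P.conj α δ w π n p) (P.conj α δ w π N p)
  linarith

end choices

theorem bijective_σ : Function.Bijective σ :=
  ⟨Function.LeftInverse.injective τ_σ, Function.RightInverse.surjective σ_τ⟩

theorem bijective_τ : Function.Bijective τ :=
  ⟨Function.LeftInverse.injective σ_τ, Function.RightInverse.surjective τ_σ⟩

theorem z_add_neg_v (k : ℕ) : P.z k + -P.v = P.z (τ k) := by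
  rw [← T_symm_z, T_symm_apply, sub_eq_add_neg]

theorem bwd_eq_conj : P.bwd α δ = P.conj α δ (-P.v) τ := by
  funext n p
  rw [bwd, conj, T_symm_apply, sub_eq_add_neg]

/-- The factors are `(r + 1)(r + 3)/(r + 2)²`, so the product telescopes to `(2/3)(N + 3)/(N + 2)`.
-/
theorem tendsto_prod_one_sub :
    Tendsto (fun N => ∏ r ∈ Finset.Icc 1 N, (1 - 1 / (((r + 2) ^ 2 : ℕ) : ℝ))) atTop (𝓝 (2 / 3)) := by
  have e : ∀ N : ℕ, ∏ r ∈ Finset.Icc 1 N, (1 - 1 / (((r + 2) ^ 2 : ℕ) : ℝ)) =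
      2 / 3 + 2 / 3 * (1 / ((N + 2 : ℕ) : ℝ)) := by
    intro N
    induction N with
    | zero => norm_num
    | succ N ih =>
      rw [Finset.prod_Icc_succ_top (by omega), ih]
      push_cast
      field_simp
      ring
  simp only [e]
  have := (tendsto_one_div_add_atTop_nhds_zero_nat (𝕜 := ℝ)).comp (tendsto_add_atTop_nat 1)
  have := (this.const_mul (2 / 3)).const_add (2 / 3)
  rw [mul_zero, add_zero] at this
  refine this.congr fun N => ?_
  simp only [Function.comp_apply]
  push_cast
  ring_nf

/-- A step moves each image by at most twice the half-side. If either image is in the square,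
`expand` makes the total loss at most the fraction `1/(r + 2)²` of the distance; otherwise nothing
moves. -/
theorem expansion_of_choice (hc : ∀ n, P.Choice α δ n (δ n)) {n m : ℕ} (hn : 1 ≤ n) (hnm : n ≤ m)
    {p q : Torus} (hpq : 1 / (n : ℝ) ≤ dist p q) :
    (∏ r ∈ Finset.Icc (n + 1) m, (1 - 1 / (((r + 2) ^ 2 : ℕ) : ℝ))) *
        dist (P.PhiSeq α δ n p) (P.PhiSeq α δ n q)
      ≤ dist (P.PhiSeq α δ m p) (P.PhiSeq α δ m q) := by
  have h := tame_of_choice hc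
  induction m, hnm using Nat.le_induction with
  | base => simp
  | succ m hm ih =>
    have f0 : (0 : ℝ) ≤ 1 - 1 / (((m + 1 + 2) ^ 2 : ℕ) : ℝ) := by
      rw [sub_nonneg, div_le_one (by positivity)]
      exact_mod_cast Nat.one_le_pow _ _ (by omega)
    rw [Finset.prod_Icc_succ_top (by omega), mul_right_comm, mul_comm]
    refine (mul_le_mul_of_nonneg_left ih f0).trans ?_
    rw [h.PhiSeq_eq_stack, h.PhiSeq_eq_stack, h.PhiSeq_eq_stack, h.PhiSeq_eq_stack,
      stack_succ_of_mem (n := m + 1) _ _ _ (mem_univ _),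
      stack_succ_of_mem (n := m + 1) _ _ _ (mem_univ _)]
    have hm1 : (1 : ℝ) / ((m + 1 : ℕ) : ℝ) ≤ 1 / n := by
      refine one_div_le_one_div_of_le (by exact_mod_cast hn) ?_
      exact_mod_cast (by omega : n ≤ m + 1)
    have ex := (hc (m + 1)).expand (by omega)
    have e1 := ex p q (hm1.trans hpq)
    have e2 := ex q p (hm1.trans (by rwa [dist_comm]))
    rw [dist_comm (P.stack α δ univ (m + 1) q) (P.stack α δ univ (m + 1) p)] at e2
    set u := P.stack α δ univ (m + 1) p
    set v := P.stack α δ univ (m + 1) q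
    have hd : (0 : ℝ) ≤ dist u v := dist_nonneg
    by_cases hm : dist u (P.z (m + 1)) ≤ δ (m + 1) ∨ dist v (P.z (m + 1)) ≤ δ (m + 1)
    · have big := hm.elim e1 e2
      have a := P.dist_Lam_self_le α (h.pos (m + 1)) (h.lt_half (m + 1)) u
      have b := P.dist_Lam_self_le α (h.pos (m + 1)) (h.lt_half (m + 1)) v
      have tri := dist_triangle4 u (P.Lam α δ (m + 1) u) (P.Lam α δ (m + 1) v) v
      rw [dist_comm u (P.Lam α δ (m + 1) u)] at tri
      have : 4 * δ (m + 1) ≤ 1 / (((m + 1 + 2) ^ 2 : ℕ) : ℝ) * dist u v := by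
        rw [one_div_mul_eq_div, le_div_iff₀ (by positivity)]
        push_cast at big ⊢
        exact big
      linarith
    · push Not at hm
      rw [P.Lam_of_notMem α δ (not_le.2 hm.1), P.Lam_of_notMem α δ (not_le.2 hm.2)]
      refine mul_le_of_le_one_left hd ?_
      rw [sub_le_self_iff]
      positivity

theorem admissible_of_choice (hc : ∀ n, P.Choice α δ n (δ n)) : P.Admissible α δ where
  pos n := (hc n).pos
  disjoint_near := (tame_of_choice hc).disjoint_near
  lt_two_pow n := (hc n).lt_pow.trans_le
    (one_div_le_one_div_of_le (by positivity) (pow_le_pow_right₀ (by norm_num) (by omega)))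
  disjoint_column n m hmn p hp e := by
    rw [mem_square] at hp
    have := ((le_max_left _ _).trans hp).trans_lt ((tame_of_choice hc).lt_dist' hmn)
    rw [e, dist_comm] at this
    exact lt_irrefl _ this
  lt_dist := (tame_of_choice hc).lt_dist
  small_fibre n p q hp hq hd := by
    rw [(tame_of_choice hc).PhiSeq_eq_stack, (tame_of_choice hc).PhiSeq_eq_stack] at hd
    exact_mod_cast (hc (n + 1)).fibre (by omega) p q hp hq hd
  expansion := ⟨fun r => (r + 2) ^ 2, fun n =>
    (by norm_num : 2 ≤ 2 ^ 2).trans (Nat.pow_le_pow_left (Nat.le_add_left 2 n) 2),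
    ⟨2 / 3, by norm_num, tendsto_prod_one_sub⟩,
    fun n m hn hnm p q hpq => expansion_of_choice hc hn hnm.le hpq⟩
  fwd_uniform := (tame_of_choice hc).uniformContinuousOn_conj P.T_z bijective_σ σ_near
  bwd_uniform n := by
    rw [bwd_eq_conj]
    exact (tame_of_choice hc).uniformContinuousOn_conj z_add_neg_v bijective_τ τ_near n
  fwd_cauchy := uniformCauchySeqOn_conj hc P.T_z bijective_σ σ_near
  bwd_cauchy := by
    rw [bwd_eq_conj]
    exact uniformCauchySeqOn_conj hc z_add_neg_v bijective_τ τ_near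

end ReesData

theorem mainTheorem2 (P : ReesData) :
    -- the construction can be carried out for every parameter
    (∀ α : ℕ → unitInterval, ∃ δ : ℕ → ℝ, P.Admissible α δ) ∧
    -- it yields a well-defined minimal homeomorphism of the torus
    (∀ (α : ℕ → unitInterval) (δ : ℕ → ℝ), P.Admissible α δ →
      (∃! S : Torus ≃ₜ Torus, P.IsSystem α δ S) ∧
      ∀ S : Torus ≃ₜ Torus, P.IsSystem α δ S → IsMinimalHomeo S) ∧
    -- and `c₀`-equivalent parameters yield conjugate homeomorphisms
    (∀ (α β : ℕ → unitInterval) (δα δβ : ℕ → ℝ), P.Admissible α δα → P.Admissible β δβ →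
      C0Rel α β → ∀ Sα Sβ : Torus ≃ₜ Torus, P.IsSystem α δα Sα → P.IsSystem β δβ Sβ →
        TopConjugate Sα Sβ) :=
  ⟨fun α => (P.exists_choices α).imp fun _ => ReesData.admissible_of_choice,
    fun _ _ hA => ⟨hA.existsUnique_system, fun _ => hA.isMinimalHomeo⟩,
    fun _ _ _ _ hA hB hαβ _ _ hS hS' => hA.topConjugate hB hαβ hS hS'⟩
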